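/- Let $q$ be a complex number with $0<|q|<1$. For $x\in\mathbb{C}$ and $n\ge 0$ put $$(x;q)_n=\prod_{i=0}^{n-1}(1-q^ix),\qquad (x;q)_\infty=\prod_{i\ge 0}(1-q^ix),\qquad (x,y;q)_n=(x;q)_n(y;q)_n,$$ and, for $x\neq 0$ and integers $m\ge 1$, $$j(x;q)=(x;q)_\infty(q/x;q)_\infty(q;q)_\infty,\qquad J_m=\prod_{i\ge 1}(1-q^{mi}).$$ Define, for nonzero $x,z$ for which no denominator vanishes, the Appell--Lerch sum $$m(x,q,z)=\frac{1}{j(z;q)}\sum_{r=-\infty}^{\infty}\frac{(-1)^rq^{\binom r2}z^r}{1-q^{r-1}xz}$$ and the universal mock theta function $$g(x,q)=x^{-1}\Big(-1+\sum_{n=0}^{\infty}\frac{q^{n^2}}{(x;q)_{n+1}(q/x;q)_n}\Big).$$ **Theorem.** Let $a$ be a nonzero complex number. The series $\sum_{n\ge 0}q^{n+1}(-q/a,-aq;q)_n$ converges absolutely, and the following hold. (B) If $-a\notin\{q^k:k\in\mathbb{Z}\}$, then all series on the right-hand side below converge absolutely, $j(-a^{-1};q)\neq 0$, and $$\Big(1+\frac1a\Big)\sum_{n=0}^{\infty}q^{n+1}(-q/a,-aq;q)_n=-1+a\,g(-a,q)+\frac{j(-a;q)}{J_1}\,m(a^2,q,-a^{-1}).$$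 (A) If $a^4\notin\{q^{2k}:k\in\mathbb{Z}\}$, then all series on the right-hand side below converge absolutely, $j(-1;q)\neq0$, $j(a^4;q^2)\neq 0$, and $$\Big(1+\frac1a\Big)\sum_{n=0}^{\infty}q^{n+1}(-q/a,-aq;q)_n=-1+a\,g(-a,q)+\frac{j(-a;q)}{J_1}\,m(a^2,q,-1)+\frac12\,\frac{j(a;q)^3\,j(qa^2;q^2)}{J_2^2\,j(a^4;q^2)}.$$ -/

import Mathlib

/-- The finite `q`-Pochhammer symbol `(x; q)_n = ∏_{i=0}^{n-1} (1 - q^i x)`. -/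
def qPoch (x q : ℂ) (n : ℕ) : ℂ := ∏ i ∈ Finset.range n, (1 - q ^ i * x)

/-- The infinite `q`-Pochhammer symbol `(x; q)_∞ = ∏_{i ≥ 0} (1 - q^i x)`. -/
noncomputable def qPochInf (x q : ℂ) : ℂ := ∏' i : ℕ, (1 - q ^ i * x)

/-- For `|q| < 1` the product defining `(x; q)_∞` converges, for every `x`. -/
theorem multipliable_qPochInf (x : ℂ) {q : ℂ} (hq : ‖q‖ < 1) :
    Multipliable (fun i : ℕ => 1 - q ^ i * x) := by
  have h : Summable (fun i : ℕ => ‖-(q ^ i * x)‖) := by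
    simp only [norm_neg, norm_mul, norm_pow]
    exact (summable_geometric_of_lt_one (norm_nonneg q) hq).mul_right ‖x‖
  simpa only [← sub_eq_add_neg] using multipliable_one_add_of_summable h

/-- The theta function `j(x; q) = (x; q)_∞ (q/x; q)_∞ (q; q)_∞`. -/
noncomputable def jTheta (x q : ℂ) : ℂ := qPochInf x q * qPochInf (q / x) q * qPochInf q q

/-- `J_m = ∏_{i ≥ 1} (1 - q^{m i}) = (q^m; q^m)_∞`. -/
noncomputable def eulerJ (m : ℕ) (q : ℂ) : ℂ := qPochInf (q ^ m) (q ^ m)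

/-- The `r`-th term `(-1)^r q^{r(r-1)/2} z^r / (1 - q^{r-1} x z)` of the Appell--Lerch series,
for an integer `r`; the integer division `r * (r - 1) / 2` is exact. -/
noncomputable def appellLerchTerm (x q z : ℂ) (r : ℤ) : ℂ :=
  (-1) ^ r * q ^ (r * (r - 1) / 2) * z ^ r / (1 - q ^ (r - 1) * x * z)

/-- The Appell--Lerch sum `m(x, q, z)`. -/
noncomputable def appellLerch (x q z : ℂ) : ℂ :=
  1 / jTheta z q * ∑' r : ℤ, appellLerchTerm x q z r

/-- The `n`-th term `q^{n^2} / ((x; q)_{n+1} (q/x; q)_n)`. -/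
noncomputable def mockGTerm (x q : ℂ) (n : ℕ) : ℂ :=
  q ^ (n ^ 2) / (qPoch x q (n + 1) * qPoch (q / x) q n)

/-- The universal mock theta function
`g(x, q) = x⁻¹ (-1 + ∑_{n ≥ 0} q^{n^2} / ((x; q)_{n+1} (q/x; q)_n))`. -/
noncomputable def mockG (x q : ℂ) : ℂ := x⁻¹ * (-1 + ∑' n : ℕ, mockGTerm x q n)

/-- The `n`-th term `q^{n+1} (-q/a; q)_n (-aq; q)_n`. -/
noncomputable def dualTerm (a q : ℂ) (n : ℕ) : ℂ :=
  q ^ (n + 1) * (qPoch (-q / a) q n * qPoch (-a * q) q n)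

open Filter Topology

section QSeries

variable {q : ℂ}

/-! Put `x = -a`. Since `(x; q)_{m+1} = (1 - x)(qx; q)_m`, the left side is `a⁻¹ D` with `D = ∑
q^{m+1} (q/x; q)_m (x; q)_{m+1}`. The finite triple product expands each summand of `D` in powers of
`x`. Summing over `m`, the coefficients become the series `binomSum`, and `(q; q)_∞ * binomSum q N`
is a partial theta series (`hasSum_binomSum`). Collecting terms by the total index leaves finite
geometric sums, whose closed forms are the paired terms `r`, `-r` of two bilateral series with
denominators `1 - q^r x` (`hasSum_dual`).

One of these series is the Appell-Lerch sum with `z = -a⁻¹` after an index shift. The other has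
numerators `(-1)^r q^{r(r+1)/2 + r²}` and is the mock theta series: expand `1 / ((x; q)_{n+1} (q/x;
q)_n)` in partial fractions and sum over `n` by Cauchy's identity (`hasSum_mockGTerm`). This gives
the identity with `z = -a⁻¹`.

The identity with `z = -1` follows by changing `z` in the Appell-Lerch sum. The cross difference of
two Appell series is a theta function times a Kronecker series (`jTheta_mul_kroneckerSeries`). The
special case `z₀ = 1` evaluates the Kronecker series as a theta quotient, so the difference is a
theta quotient too. This holds first in an annulus, then by quasi-periodicity off countably many
circles, then everywhere by continuity (`appellDefect_eq_zero`). A product identity puts the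
correction into the stated form. -/

/-! ### Terms of the theta series. -/

theorem tri_add (m n : ℤ) :
    (m + n) * (m + n - 1) / 2 = m * (m - 1) / 2 + n * (n - 1) / 2 + m * n := by
  have h (k : ℤ) : ∃ t, k * (k - 1) = 2 * t := by
    rcases Int.even_or_odd' k with ⟨c, rfl | rfl⟩
    · exact ⟨c * (2 * c - 1), by ring⟩
    · exact ⟨(2 * c + 1) * c, by ring⟩
  obtain ⟨a, ha⟩ := h m
  obtain ⟨b, hb⟩ := h n
  have hc : (m + n) * (m + n - 1) = 2 * (a + b + m * n) := by linear_combination ha + hb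
  rw [ha, hb, hc]
  simp

/-- The general term `(-1)^n q^{n(n-1)/2} z^n` of the theta series. -/
noncomputable def thetaTerm (q z : ℂ) (n : ℤ) : ℂ := (-1) ^ n * q ^ (n * (n - 1) / 2) * z ^ n

@[simp] theorem thetaTerm_zero (q z : ℂ) : thetaTerm q z 0 = 1 := by simp [thetaTerm]

@[simp] theorem thetaTerm_one (q z : ℂ) : thetaTerm q z 1 = -z := by simp [thetaTerm]

theorem thetaTerm_ne_zero (hq0 : q ≠ 0) {z : ℂ} (hz : z ≠ 0) (n : ℤ) : thetaTerm q z n ≠ 0 := by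
  unfold thetaTerm
  have : (-1 : ℂ) ^ n ≠ 0 := zpow_ne_zero _ (by norm_num)
  have := zpow_ne_zero (n * (n - 1) / 2) hq0
  have := zpow_ne_zero n hz
  positivity

/-- The exponent is quadratic in the index, so multiplicativity fails only by the cross term `q ^ (m
* n)`. Every index shift below rests on this. -/
theorem thetaTerm_add (hq0 : q ≠ 0) {z : ℂ} (hz : z ≠ 0) (m n : ℤ) :
    thetaTerm q z (m + n) = thetaTerm q z m * thetaTerm q z n * q ^ (m * n) := by
  unfold thetaTerm
  rw [tri_add, zpow_add₀ hz, zpow_add₀ hq0, zpow_add₀ hq0, zpow_add₀ (by norm_num)]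
  ring

theorem thetaTerm_mul (q z w : ℂ) (n : ℤ) : thetaTerm q (z * w) n = thetaTerm q z n * w ^ n := by
  unfold thetaTerm
  rw [mul_zpow]
  ring

theorem thetaTerm_add_one (hq0 : q ≠ 0) {z : ℂ} (hz : z ≠ 0) (n : ℤ) :
    thetaTerm q z (n + 1) = -(q ^ n * z) * thetaTerm q z n := by
  rw [thetaTerm_add hq0 hz]
  simp
  ring

theorem thetaTerm_neg (hq0 : q ≠ 0) {z : ℂ} (hz : z ≠ 0) (n : ℤ) :
    thetaTerm q z (-n) = thetaTerm q (q / z) n := by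
  have h1 := thetaTerm_add hq0 hz (-n) n
  rw [neg_add_cancel, thetaTerm_zero] at h1
  have h2 : thetaTerm q (q / z) n * thetaTerm q z n = q ^ (n * n) := by
    unfold thetaTerm
    have h3 : (q / z) ^ n * z ^ n = q ^ n := by
      rw [← mul_zpow, div_mul_cancel₀ _ hz]
    have h4 : q ^ (n * (n - 1) / 2) * q ^ (n * (n - 1) / 2) * q ^ n = q ^ (n * n) := by
      rw [← zpow_add₀ hq0, ← zpow_add₀ hq0]
      congr 1
      have : n * (n - 1) / 2 + n * (n - 1) / 2 = n * (n - 1) := by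
        rw [← two_mul]
        exact Int.mul_ediv_cancel' (Int.even_mul_pred_self n).two_dvd
      rw [this]; ring
    have h5 : (-1 : ℂ) ^ n * (-1) ^ n = 1 := by rw [← mul_zpow]; simp
    calc _ = ((-1 : ℂ) ^ n * (-1) ^ n) * (q ^ (n * (n - 1) / 2) * q ^ (n * (n - 1) / 2) *
              ((q / z) ^ n * z ^ n)) := by ring
      _ = _ := by rw [h5, h3, h4, one_mul]
  have h6 : q ^ (n * n) * q ^ (-n * n) = 1 := by
    rw [← zpow_add₀ hq0]; simp
  have h7 := thetaTerm_ne_zero hq0 hz n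
  apply mul_right_cancel₀ h7
  rw [h2]
  apply mul_right_cancel₀ (zpow_ne_zero (-n * n) hq0)
  rw [h6, ← h1]

theorem summable_norm_thetaTerm_nat (hq0 : q ≠ 0) (hq1 : ‖q‖ < 1) {z : ℂ} (hz : z ≠ 0) :
    Summable (fun n : ℕ => ‖thetaTerm q z n‖) := by
  refine summable_of_ratio_test_tendsto_lt_one (l := 0) one_pos
    (Eventually.of_forall fun n => norm_ne_zero_iff.2 (thetaTerm_ne_zero hq0 hz _)) ?_
  have h (n : ℕ) : ‖‖thetaTerm q z ((n + 1 : ℕ) : ℤ)‖‖ / ‖‖thetaTerm q z (n : ℤ)‖‖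
      = ‖q‖ ^ n * ‖z‖ := by
    push_cast
    rw [thetaTerm_add_one hq0 hz, norm_norm, norm_norm, norm_mul,
      mul_div_cancel_right₀ _ (norm_ne_zero_iff.2 (thetaTerm_ne_zero hq0 hz _))]
    simp
  simp_rw [h]
  simpa using (tendsto_pow_atTop_nhds_zero_of_lt_one (norm_nonneg q) hq1).mul_const ‖z‖

theorem summable_norm_thetaTerm (hq0 : q ≠ 0) (hq1 : ‖q‖ < 1) {z : ℂ} (hz : z ≠ 0) :
    Summable (fun n : ℤ => ‖thetaTerm q z n‖) := by
  refine Summable.of_nat_of_neg (summable_norm_thetaTerm_nat hq0 hq1 hz) ?_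
  simp_rw [thetaTerm_neg hq0 hz]
  exact summable_norm_thetaTerm_nat hq0 hq1 (div_ne_zero hq0 hz)

theorem summable_thetaTerm (hq0 : q ≠ 0) (hq1 : ‖q‖ < 1) {z : ℂ} (hz : z ≠ 0) :
    Summable (thetaTerm q z) := (summable_norm_thetaTerm hq0 hq1 hz).of_norm

/-! ### Pochhammer symbols -/

@[simp] theorem qPoch_zero (x q : ℂ) : qPoch x q 0 = 1 := by simp [qPoch]

theorem qPoch_succ (x q : ℂ) (n : ℕ) : qPoch x q (n + 1) = qPoch x q n * (1 - q ^ n * x) := by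
  simp [qPoch, Finset.prod_range_succ]

theorem qPoch_add (x q : ℂ) (m n : ℕ) :
    qPoch x q (m + n) = qPoch x q m * qPoch (q ^ m * x) q n := by
  simp only [qPoch, Finset.prod_range_add]
  congr 1
  exact Finset.prod_congr rfl fun i _ => by ring

theorem qPoch_succ_left (x q : ℂ) (n : ℕ) : qPoch x q (n + 1) = (1 - x) * qPoch (q * x) q n := by
  rw [add_comm, qPoch_add]
  simp [qPoch]

theorem tendsto_qPoch (x : ℂ) (hq1 : ‖q‖ < 1) :
    Tendsto (fun n => qPoch x q n) atTop (𝓝 (qPochInf x q)) :=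
  (multipliable_qPochInf x hq1).tendsto_prod_tprod_nat

theorem qPochInf_ne_zero (hq1 : ‖q‖ < 1) {x : ℂ} (hx : ∀ n : ℕ, 1 - q ^ n * x ≠ 0) :
    qPochInf x q ≠ 0 := by
  have h : Summable (fun i : ℕ => ‖-(q ^ i * x)‖) := by
    simp only [norm_neg, norm_mul, norm_pow]
    exact (summable_geometric_of_lt_one (norm_nonneg q) hq1).mul_right ‖x‖
  have := tprod_one_add_ne_zero_of_summable (f := fun i : ℕ => -(q ^ i * x))
    (fun i => by simpa only [← sub_eq_add_neg] using hx i) h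
  simpa only [← sub_eq_add_neg, qPochInf] using this

theorem qPochInf_eq_mul (x : ℂ) (hq1 : ‖q‖ < 1) :
    qPochInf x q = (1 - x) * qPochInf (q * x) q := by
  have h1 := (tendsto_qPoch x hq1).comp (tendsto_add_atTop_nat 1)
  have h2 := (tendsto_qPoch (q * x) hq1).const_mul (1 - x)
  refine tendsto_nhds_unique h1 (h2.congr fun n => ?_)
  simp [qPoch_succ_left]

theorem exists_norm_le_of_tendsto {f : ℕ → ℂ} {l : ℂ} (h : Tendsto f atTop (𝓝 l)) :
    ∃ C, 0 < C ∧ ∀ n, ‖f n‖ ≤ C := by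
  obtain ⟨C, hC⟩ := h.norm.bddAbove_range
  exact ⟨max C 1, by positivity, fun n => (hC ⟨n, rfl⟩).trans (le_max_left _ _)⟩

theorem one_sub_pow_ne_zero (hq1 : ‖q‖ < 1) {n : ℕ} (hn : n ≠ 0) : 1 - q ^ n ≠ 0 := by
  intro h
  have h2 : ‖q ^ n‖ = 1 := by rw [← sub_eq_zero.1 h]; simp
  rw [norm_pow] at h2
  exact (pow_lt_one₀ (norm_nonneg _) hq1 hn).ne h2

theorem qPoch_self_ne_zero (hq1 : ‖q‖ < 1) (n : ℕ) : qPoch q q n ≠ 0 := by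
  refine Finset.prod_ne_zero_iff.2 fun i _ => ?_
  rw [← pow_succ]
  exact one_sub_pow_ne_zero hq1 i.succ_ne_zero

theorem qPochInf_self_ne_zero (hq1 : ‖q‖ < 1) : qPochInf q q ≠ 0 :=
  qPochInf_ne_zero hq1 fun n => by
    rw [← pow_succ]
    exact one_sub_pow_ne_zero hq1 n.succ_ne_zero

/-! ### Reciprocal Pochhammer symbols, the `q`-binomial theorem and the triple product. -/

/-- `1 / (q; q)_n` for an integer `n`, understood as `0` for negative `n`. -/
noncomputable def invPoch (q : ℂ) (n : ℤ) : ℂ := if n < 0 then 0 else (qPoch q q n.toNat)⁻¹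

theorem invPoch_of_neg (q : ℂ) {n : ℤ} (hn : n < 0) : invPoch q n = 0 := by simp [invPoch, hn]

@[simp] theorem invPoch_natCast (q : ℂ) (n : ℕ) : invPoch q n = (qPoch q q n)⁻¹ := by
  simp [invPoch]

/-- With the value zero at negative indices the recurrence holds for every integer, since at `n = 0`
the factor `1 - q ^ n` vanishes. Finite sums can thus be treated as sums over `ℤ` without boundary
terms. -/
theorem invPoch_sub_one (hq1 : ‖q‖ < 1) (n : ℤ) :
    invPoch q (n - 1) = (1 - q ^ n) * invPoch q n := by
  rcases lt_trichotomy n 0 with h | rfl | h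
  · rw [invPoch_of_neg q h, invPoch_of_neg q (by omega), mul_zero]
  · rw [invPoch_of_neg q (by omega)]; simp
  · obtain ⟨m, rfl⟩ : ∃ m : ℕ, n = (m + 1 : ℕ) := ⟨n.toNat - 1, by omega⟩
    rw [invPoch_natCast, show ((m + 1 : ℕ) : ℤ) - 1 = m by push_cast; ring, invPoch_natCast,
      zpow_natCast]
    have h1 := qPoch_self_ne_zero hq1 (m + 1)
    have h2 := qPoch_self_ne_zero hq1 m
    rw [qPoch_succ, ← pow_succ] at h1 ⊢
    have h3 := right_ne_zero_of_mul h1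
    field_simp

theorem tendsto_invPoch_natCast (hq1 : ‖q‖ < 1) :
    Tendsto (fun n : ℕ => invPoch q n) atTop (𝓝 (qPochInf q q)⁻¹) := by
  simp_rw [invPoch_natCast]
  exact (tendsto_qPoch q hq1).inv₀ (qPochInf_self_ne_zero hq1)

theorem tendsto_invPoch (hq1 : ‖q‖ < 1) :
    Tendsto (invPoch q) atTop (𝓝 (qPochInf q q)⁻¹) := by
  rw [← Nat.map_cast_int_atTop, tendsto_map'_iff]
  exact tendsto_invPoch_natCast hq1

theorem exists_norm_invPoch_le (hq1 : ‖q‖ < 1) : ∃ C, 0 < C ∧ ∀ n, ‖invPoch q n‖ ≤ C := by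
  obtain ⟨C, hC, h⟩ := exists_norm_le_of_tendsto (tendsto_invPoch_natCast hq1)
  refine ⟨C, hC, fun n => ?_⟩
  rcases lt_or_ge n 0 with hn | hn
  · rw [invPoch_of_neg q hn, norm_zero]; exact hC.le
  · obtain ⟨m, rfl⟩ := Int.eq_ofNat_of_zero_le hn
    exact h m

theorem hasSum_of_eq {ι : Type*} {f g : ι → ℂ} {s t : ℂ} (h : HasSum f s) (hfg : ∀ i, g i = f i)
    (hst : t = s) : HasSum g t := by
  rw [hst, funext hfg]
  exact h

theorem hasSum_comp_sub {f : ℤ → ℂ} {s : ℂ} (h : HasSum f s) (m : ℤ) :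
    HasSum (fun k => f (k - m)) s :=
  (Equiv.subRight m).hasSum_iff.2 h

theorem hasSum_comp_add {f : ℤ → ℂ} {s : ℂ} (h : HasSum f s) (m : ℤ) :
    HasSum (fun k => f (k + m)) s :=
  (Equiv.addRight m).hasSum_iff.2 h

/-- The finite `q`-binomial theorem. -/
theorem hasSum_qBinomial (hq0 : q ≠ 0) (hq1 : ‖q‖ < 1) {z : ℂ} (hz : z ≠ 0) (n : ℕ) :
    HasSum (fun k : ℤ => thetaTerm q z k * (invPoch q k * invPoch q (n - k)))
      (qPoch z q n * invPoch q n) := by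
  induction n with
  | zero =>
    refine hasSum_of_eq (hasSum_single (0 : ℤ) fun k hk => ?_) (fun _ => rfl) ?_
    rotate_left
    · simp [invPoch]
    · rcases lt_or_gt_of_ne hk with h | h
      · simp [invPoch_of_neg q h]
      · rw [invPoch_of_neg q (n := ((0 : ℕ) : ℤ) - k) (by push_cast; omega)]; simp
  | succ n ih =>
    have h0 : (1 : ℂ) - q ^ (n + 1) ≠ 0 := one_sub_pow_ne_zero hq1 n.succ_ne_zero
    -- This is multiplication by the new factor `1 - q ^ n * z`; comparing coefficients is the
    -- `q`-Pascal rule.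
    have h1 := (ih.sub ((hasSum_comp_sub ih 1).mul_left (z * q ^ n))).mul_left (1 - q ^ (n + 1))⁻¹
    refine hasSum_of_eq h1 (fun k => ?_) ?_
    · rw [eq_inv_mul_iff_mul_eq₀ h0]
      have e1 := thetaTerm_add_one hq0 hz (k - 1)
      rw [sub_add_cancel] at e1
      have e2 := invPoch_sub_one hq1 ((n : ℤ) + 1 - k)
      have e3 := invPoch_sub_one hq1 k
      rw [show (n : ℤ) + 1 - k - 1 = n - k by ring] at e2
      rw [show (n : ℤ) - (k - 1) = n + 1 - k by ring]
      push_cast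
      rw [e2, e3, e1]
      have e4 : q ^ (k - 1) * q ^ ((n : ℤ) + 1 - k) = q ^ n := by
        rw [← zpow_add₀ hq0, ← zpow_natCast]; congr 1; ring
      have e5 : q ^ ((n : ℤ) + 1 - k) * q ^ k = q ^ (n + 1) := by
        rw [← zpow_add₀ hq0, ← zpow_natCast]; congr 1; push_cast; ring
      linear_combination (-1) * z * thetaTerm q z (k - 1) * invPoch q k * invPoch q (n + 1 - k) *
        (e5 * q ^ (k - 1) + e4 * (1 - q ^ k))
    · have e := invPoch_sub_one hq1 ((n + 1 : ℕ) : ℤ)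
      rw [show ((n + 1 : ℕ) : ℤ) - 1 = n by push_cast; ring, zpow_natCast] at e
      rw [eq_inv_mul_iff_mul_eq₀ h0, e, qPoch_succ]
      ring

/-- Each factor `1 - x q^{-i}`, `1 ≤ i ≤ m`, equals `-x q^{-i} (1 - q^i / x)`. This turns the
`q`-binomial theorem at `x q^{-m}`, recentred by `m`, into the finite triple product. -/
theorem qPoch_mul_inv_pow (hq0 : q ≠ 0) {x : ℂ} (hx : x ≠ 0) (m : ℕ) :
    qPoch (x * q ^ (-m : ℤ)) q m = thetaTerm q x m * q ^ (-(m * m) : ℤ) * qPoch (q / x) q m := by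
  induction m with
  | zero => simp
  | succ m ih =>
    rw [qPoch_succ_left, qPoch_succ]
    have e1 : q * (x * q ^ (-((m + 1 : ℕ) : ℤ))) = x * q ^ (-m : ℤ) := by
      rw [show (-m : ℤ) = 1 + -((m + 1 : ℕ) : ℤ) by push_cast; ring, zpow_add₀ hq0]
      simp; ring
    have e2 : q ^ (-(((m + 1 : ℕ) : ℤ) * ((m + 1 : ℕ) : ℤ))) * q ^ (m : ℤ)
        = q ^ (-((m : ℤ) * m)) * q ^ (-((m + 1 : ℕ) : ℤ)) := by
      rw [← zpow_add₀ hq0, ← zpow_add₀ hq0]; congr 1; push_cast; ring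
    have e3 : q ^ (-((m + 1 : ℕ) : ℤ)) * q ^ (m + 1) = 1 := by
      rw [← zpow_natCast, ← zpow_add₀ hq0]; simp
    rw [e1, ih]
    push_cast at e2 e3 ⊢
    rw [thetaTerm_add_one hq0 hx]
    have e4 : q ^ m * (q / x) = q ^ (m + 1) / x := by ring
    rw [e4]
    have e5 : x * (q ^ (m + 1) / x) = q ^ (m + 1) := by field_simp
    linear_combination (-1 : ℂ) * (- (x * thetaTerm q x m * qPoch (q / x) q m)) * (1 - q ^ (m + 1) / x) * e2
      - thetaTerm q x m * qPoch (q / x) q m * q ^ (-((m : ℤ) * m)) * (q ^ (-((m : ℤ) + 1)) * e5 + e3)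

/-- The finite form of the Jacobi triple product. -/
theorem hasSum_finite_tripleProduct (hq0 : q ≠ 0) (hq1 : ‖q‖ < 1) {x : ℂ} (hx : x ≠ 0) (m l : ℕ) :
    HasSum (fun k : ℤ => thetaTerm q x k * (invPoch q (m + k) * invPoch q (l - k)))
      (qPoch (q / x) q m * qPoch x q l * invPoch q (m + l)) := by
  have hz : x * q ^ (-m : ℤ) ≠ 0 := mul_ne_zero hx (zpow_ne_zero _ hq0)
  have h := hasSum_comp_add (hasSum_qBinomial hq0 hq1 hz (m + l)) m
  have h0 : thetaTerm q x m * q ^ (-(m * m) : ℤ) ≠ 0 :=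
    mul_ne_zero (thetaTerm_ne_zero hq0 hx _) (zpow_ne_zero _ hq0)
  refine hasSum_of_eq (h.mul_left (thetaTerm q x m * q ^ (-(m * m) : ℤ))⁻¹) (fun k => ?_) ?_
  · rw [eq_inv_mul_iff_mul_eq₀ h0, thetaTerm_mul, thetaTerm_add hq0 hx, ← zpow_mul, add_comm k]
    have e : q ^ (k * (m : ℤ)) * q ^ (-(m : ℤ) * (m + k)) = q ^ (-(m * m) : ℤ) := by
      rw [← zpow_add₀ hq0]; congr 1; ring
    rw [show ((m + l : ℕ) : ℤ) - (m + k) = l - k by push_cast; ring]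
    linear_combination (-1) * thetaTerm q x k * thetaTerm q x m * invPoch q (m + k) *
      invPoch q (l - k) * e
  · rw [eq_inv_mul_iff_mul_eq₀ h0, qPoch_add _ _ m l, qPoch_mul_inv_pow hq0 hx]
    have e : q ^ m * (x * q ^ (-m : ℤ)) = x := by
      rw [mul_left_comm, ← zpow_natCast, ← zpow_add₀ hq0]; simp
    rw [e, show ((m + l : ℕ) : ℤ) = m + l by push_cast; ring]
    ring

/-- The Jacobi triple product. -/
theorem hasSum_thetaTerm (hq0 : q ≠ 0) (hq1 : ‖q‖ < 1) {x : ℂ} (hx : x ≠ 0) :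
    HasSum (thetaTerm q x) (jTheta x q) := by
  have hE := qPochInf_self_ne_zero hq1
  obtain ⟨C, hC0, hC⟩ := exists_norm_invPoch_le hq1
  have h1 : Tendsto (fun m : ℕ =>
      ∑' k : ℤ, thetaTerm q x k * (invPoch q (m + k) * invPoch q (m - k))) atTop
      (𝓝 (∑' k : ℤ, thetaTerm q x k * ((qPochInf q q)⁻¹ * (qPochInf q q)⁻¹))) := by
    refine tendsto_tsum_of_dominated_convergence (bound := fun k => ‖thetaTerm q x k‖ * (C * C))
      ((summable_norm_thetaTerm hq0 hq1 hx).mul_right _) (fun k => ?_) (Eventually.of_forall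
      fun m k => ?_)
    · exact tendsto_const_nhds.mul (((tendsto_invPoch hq1).comp
        (tendsto_atTop_add_const_right _ _ tendsto_natCast_atTop_atTop)).mul
        ((tendsto_invPoch hq1).comp
        (tendsto_atTop_add_const_right _ _ tendsto_natCast_atTop_atTop)))
    · rw [norm_mul, norm_mul]
      gcongr <;> apply hC
  have h2 : Tendsto (fun m : ℕ => qPoch (q / x) q m * qPoch x q m * invPoch q (m + m))
      atTop (𝓝 (qPochInf (q / x) q * qPochInf x q * (qPochInf q q)⁻¹)) := by
    refine ((tendsto_qPoch _ hq1).mul (tendsto_qPoch x hq1)).mul ((tendsto_invPoch hq1).comp ?_)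
    exact tendsto_natCast_atTop_atTop.atTop_add_atTop tendsto_natCast_atTop_atTop
  have h3 := tendsto_nhds_unique h1 (h2.congr fun m =>
    (hasSum_finite_tripleProduct hq0 hq1 hx m m).tsum_eq.symm)
  rw [tsum_mul_right] at h3
  convert (summable_thetaTerm hq0 hq1 hx).hasSum using 1
  unfold jTheta
  field_simp at h3
  rw [h3]
  ring

/-! ### Elementary properties of the theta function -/

/-- Quasi-periodicity is an index shift by `i` in the theta series. -/
theorem jTheta_zpow_mul (hq0 : q ≠ 0) (hq1 : ‖q‖ < 1) {z : ℂ} (hz : z ≠ 0) (i : ℤ) :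
    jTheta (q ^ i * z) q = jTheta z q / thetaTerm q z i := by
  have h1 := hasSum_thetaTerm hq0 hq1 (mul_ne_zero (zpow_ne_zero i hq0) hz)
  have h2 := (hasSum_comp_add (hasSum_thetaTerm hq0 hq1 hz) i).div_const (thetaTerm q z i)
  refine h1.unique (hasSum_of_eq h2 (fun n => ?_) rfl)
  rw [eq_div_iff (thetaTerm_ne_zero hq0 hz i), thetaTerm_add hq0 hz, mul_comm (q ^ i),
    thetaTerm_mul, ← zpow_mul, mul_comm i n]
  ring

theorem jTheta_mul_self (hq0 : q ≠ 0) (hq1 : ‖q‖ < 1) {z : ℂ} (hz : z ≠ 0) :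
    jTheta (q * z) q = -z⁻¹ * jTheta z q := by
  simpa [div_eq_inv_mul, inv_neg] using jTheta_zpow_mul hq0 hq1 hz 1

theorem jTheta_div (hq0 : q ≠ 0) (z : ℂ) : jTheta (q / z) q = jTheta z q := by
  unfold jTheta
  rw [div_div_cancel₀ hq0, mul_comm (qPochInf (q / z) q)]

theorem jTheta_inv (hq0 : q ≠ 0) (hq1 : ‖q‖ < 1) {z : ℂ} (hz : z ≠ 0) :
    jTheta z⁻¹ q = -z⁻¹ * jTheta z q := by
  have h := jTheta_mul_self hq0 hq1 (inv_ne_zero hz)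
  rw [← div_eq_mul_inv, jTheta_div hq0] at h
  rw [h]
  field_simp

theorem jTheta_one (hq1 : ‖q‖ < 1) : jTheta 1 q = 0 := by
  unfold jTheta
  rw [qPochInf_eq_mul 1 hq1]
  simp

theorem jTheta_ne_zero (hq1 : ‖q‖ < 1) {z : ℂ} (hz0 : z ≠ 0)
    (hz : ∀ k : ℤ, z ≠ q ^ k) : jTheta z q ≠ 0 := by
  refine mul_ne_zero (mul_ne_zero (qPochInf_ne_zero hq1 fun n h => hz (-n) ?_)
    (qPochInf_ne_zero hq1 fun n h => hz (n + 1) ?_)) (qPochInf_self_ne_zero hq1)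
  · rw [zpow_neg, zpow_natCast]
    exact eq_inv_of_mul_eq_one_right (sub_eq_zero.1 h).symm
  · have := (sub_eq_zero.1 h)
    field_simp at this
    rw [this]
    norm_cast

/-! ### Lower bounds for the denominators and partial fractions. -/

theorem one_sub_zpow_mul_ne_zero {w : ℂ} (hw : ∀ k : ℤ, w ≠ q ^ k) (r : ℤ) :
    1 - q ^ r * w ≠ 0 := by
  intro h
  refine hw (-r) ?_
  rw [zpow_neg]
  exact eq_inv_of_mul_eq_one_right (sub_eq_zero.1 h).symm

/-- The ratio of the two sides without `δ` tends to 1 as `r → ±∞` and never vanishes, so it is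
bounded below. The growth term `‖q ^ r * w‖` is needed where the numerators alone do not decay as `r
→ -∞`, as in the Kronecker series. -/
theorem exists_le_norm_one_sub (hq0 : q ≠ 0) (hq1 : ‖q‖ < 1) {w : ℂ} (hw0 : w ≠ 0)
    (hw : ∀ k : ℤ, w ≠ q ^ k) :
    ∃ δ : ℝ, 0 < δ ∧ ∀ r : ℤ, δ * (1 + ‖q ^ r * w‖) ≤ ‖1 - q ^ r * w‖ := by
  set ρ : ℤ → ℝ := fun r => ‖1 - q ^ r * w‖ / (1 + ‖q ^ r * w‖) with hρ
  have hpos (r : ℤ) : 0 < 1 + ‖q ^ r * w‖ := by positivity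
  have hρ0 (r : ℤ) : 0 < ρ r :=
    div_pos (norm_pos_iff.2 (one_sub_zpow_mul_ne_zero hw r)) (hpos r)
  suffices h : ∃ δ : ℝ, 0 < δ ∧ ∀ r, δ ≤ ρ r by
    obtain ⟨δ, h0, h⟩ := h
    exact ⟨δ, h0, fun r => (le_div_iff₀ (hpos r)).1 (h r)⟩
  have hlim := (tendsto_pow_atTop_nhds_zero_of_lt_one (norm_nonneg q) hq1).mul_const ‖w‖
  have hlim' := (tendsto_pow_atTop_nhds_zero_of_lt_one (norm_nonneg q) hq1).mul_const ‖w‖⁻¹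
  rw [zero_mul] at hlim hlim'
  -- The triangle inequality gives a ratio of at least `1 / 3` as soon as the norm of `q ^ r * w` is
  -- at most `1 / 2` or at least `2`.
  have hfin : {r | ¬ (1 / 3 ≤ ρ r)}.Finite := by
    rw [← eventually_cofinite, Int.cofinite_eq, eventually_sup]
    constructor
    · have h1 : ∀ᶠ n : ℕ in atTop, 1 / 3 ≤ ρ (-(n : ℤ)) := by
        filter_upwards [hlim'.eventually_le_const (show (0 : ℝ) < 1 / 2 by norm_num)] with n hn
        rw [hρ, le_div_iff₀ (hpos _)]
        have h2 : 2 ≤ ‖q ^ (-(n : ℤ)) * w‖ := by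
          have : ‖q ^ (-(n : ℤ)) * w‖ = (‖q‖ ^ n * ‖w‖⁻¹)⁻¹ := by simp [mul_comm]
          rw [this]
          have hp : 0 < ‖q‖ ^ n * ‖w‖⁻¹ := by positivity
          rw [le_inv_comm₀ two_pos hp]
          simpa using hn
        have h3 := norm_sub_norm_le (q ^ (-(n : ℤ)) * w) 1
        rw [norm_sub_rev, norm_one] at h3
        linarith
      have h4 : atBot = map (fun n : ℕ => -(n : ℤ)) atTop := by
        have : (fun n : ℕ => -(n : ℤ)) = Neg.neg ∘ ((↑) : ℕ → ℤ) := rfl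
        rw [this, ← map_map, Nat.map_cast_int_atTop, map_neg_atTop]
      rw [h4, eventually_map]
      exact h1
    · rw [← Nat.map_cast_int_atTop, eventually_map]
      filter_upwards [hlim.eventually_le_const (show (0 : ℝ) < 1 / 2 by norm_num)] with n hn
      rw [hρ, le_div_iff₀ (hpos _)]
      have h2 : ‖q ^ (n : ℤ) * w‖ ≤ 1 / 2 := by simpa using hn
      have h3 := norm_sub_norm_le 1 (q ^ (n : ℤ) * w)
      rw [norm_one] at h3
      linarith
  rcases Set.eq_empty_or_nonempty {r | ¬ (1 / 3 ≤ ρ r)} with he | hne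
  · refine ⟨1 / 3, by norm_num, fun r => ?_⟩
    by_contra h
    exact (Set.eq_empty_iff_forall_notMem.1 he) r h
  · obtain ⟨r₀, -, hr₀⟩ := Set.exists_min_image _ ρ hfin hne
    refine ⟨min (1 / 3) (ρ r₀), lt_min (by norm_num) (hρ0 _), fun r => ?_⟩
    by_cases h : 1 / 3 ≤ ρ r
    · exact (min_le_left _ _).trans h
    · exact (min_le_right _ _).trans (hr₀ r h)

theorem summable_norm_div_one_sub (hq0 : q ≠ 0) (hq1 : ‖q‖ < 1) {w : ℂ} (hw0 : w ≠ 0)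
    (hw : ∀ k : ℤ, w ≠ q ^ k) {f : ℤ → ℂ} (hf : Summable fun r => ‖f r‖) :
    Summable (fun r : ℤ => ‖f r / (1 - q ^ r * w)‖) := by
  obtain ⟨δ, hδ, h⟩ := exists_le_norm_one_sub hq0 hq1 hw0 hw
  refine (hf.mul_right δ⁻¹).of_nonneg_of_le (fun _ => norm_nonneg _) fun r => ?_
  rw [norm_div, div_eq_mul_inv]
  have h1 : δ ≤ ‖1 - q ^ r * w‖ := by
    refine le_trans ?_ (h r)
    nlinarith [norm_nonneg (q ^ r * w)]
  gcongr

theorem summable_thetaTerm_div (hq0 : q ≠ 0) (hq1 : ‖q‖ < 1) {z w : ℂ} (hz : z ≠ 0) (hw0 : w ≠ 0)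
    (hw : ∀ k : ℤ, w ≠ q ^ k) : Summable (fun r : ℤ => thetaTerm q z r / (1 - q ^ r * w)) :=
  (summable_norm_div_one_sub hq0 hq1 hw0 hw (summable_norm_thetaTerm hq0 hq1 hz)).of_norm

theorem summable_norm_thetaTerm_mul_invPoch (hq0 : q ≠ 0) (hq1 : ‖q‖ < 1) {z : ℂ} (hz : z ≠ 0)
    (m n : ℤ) :
    Summable (fun r : ℤ => ‖thetaTerm q z r * (invPoch q (m - r) * invPoch q (n + r))‖) := by
  obtain ⟨C, hC0, hC⟩ := exists_norm_invPoch_le hq1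
  refine ((summable_norm_thetaTerm hq0 hq1 hz).mul_right (C * C)).of_nonneg_of_le
    (fun _ => norm_nonneg _) fun r => ?_
  rw [norm_mul, norm_mul]
  gcongr <;> apply hC

/-- The partial fraction expansion of `1 / ((x; q)_{n+1} (q/x; q)_n)`. -/
theorem hasSum_partialFraction (hq0 : q ≠ 0) (hq1 : ‖q‖ < 1) {x : ℂ} (hx0 : x ≠ 0)
    (hx : ∀ k : ℤ, x ≠ q ^ k) (n : ℕ) :
    HasSum (fun r : ℤ => thetaTerm q q r * (invPoch q (n - r) * invPoch q (n + r)) /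
      (1 - q ^ r * x)) (1 / (qPoch x q (n + 1) * qPoch (q / x) q n)) := by
  induction n with
  | zero =>
    refine hasSum_of_eq (hasSum_single (0 : ℤ) fun k hk => ?_) (fun _ => rfl) ?_
    rotate_left
    · simp [invPoch, qPoch]
    · rcases lt_or_gt_of_ne hk with h | h
      · simp [invPoch_of_neg q h]
      · rw [invPoch_of_neg q (n := ((0 : ℕ) : ℤ) - k) (by push_cast; omega)]; simp
  | succ n ih =>
    have hA1 : 1 - q ^ (n + 1) * x ≠ 0 := one_sub_zpow_mul_ne_zero hx (n + 1 : ℕ)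
    have hA2 : 1 - q ^ (n + 1) / x ≠ 0 := by
      intro h
      rw [sub_eq_zero, eq_div_iff hx0, one_mul] at h
      exact hx (n + 1 : ℕ) (by rw [h]; norm_cast)
    have hs := (summable_norm_div_one_sub hq0 hq1 hx0 hx
      (summable_norm_thetaTerm_mul_invPoch hq0 hq1 hq0 (n + 1 : ℕ) (n + 1 : ℕ))).of_norm.hasSum
    -- Multiplying by `(1 - q^{n+1} x)(1 - q^{n+1} / x)` agrees with the coefficient ratio `(1 -
    -- q^{n+1-r})(1 - q^{n+1+r})` up to `q^{n+1} (q^{-r} - x⁻¹)(1 - q^r x)`. The last factor cancels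
    -- the denominator, leaving finite theta sums at `1` and `q`; both vanish because `(1; q)_{n+1}
    -- = 0`.
    have z1 := hasSum_finite_tripleProduct hq0 hq1 one_ne_zero (n + 1) (n + 1)
    have z2 := hasSum_finite_tripleProduct hq0 hq1 hq0 (n + 1) (n + 1)
    have p1 : qPoch 1 q (n + 1) = 0 := by rw [qPoch_succ_left]; simp
    rw [p1] at z1
    rw [div_self hq0, p1] at z2
    simp only [mul_zero, zero_mul] at z1 z2
    have key := ih.unique (hasSum_of_eq ((hs.mul_left ((1 - q ^ (n + 1) * x) *
      (1 - q ^ (n + 1) / x))).sub ((z1.sub (z2.mul_left x⁻¹)).mul_left (q ^ (n + 1))))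
      (fun r => ?_) rfl)
    · simp only [mul_zero, sub_zero] at key
      refine hasSum_of_eq hs (fun _ => rfl) ?_
      rw [qPoch_succ _ _ (n + 1), qPoch_succ (q / x)]
      rw [show q ^ n * (q / x) = q ^ (n + 1) / x by ring]
      have hA := mul_ne_zero hA1 hA2
      rw [eq_comm, ← mul_right_inj' hA, ← key, mul_mul_mul_comm, one_div, one_div,
        mul_inv (_ * qPoch (q / x) q n), mul_left_comm, mul_inv_cancel₀ hA, mul_one]
    · have e1 := invPoch_sub_one hq1 ((n : ℤ) + 1 - r)
      have e2 := invPoch_sub_one hq1 ((n : ℤ) + 1 + r)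
      rw [show (n : ℤ) + 1 - r - 1 = n - r by ring] at e1
      rw [show (n : ℤ) + 1 + r - 1 = n + r by ring] at e2
      have e3 : thetaTerm q 1 r * q ^ r = thetaTerm q q r := by
        rw [← thetaTerm_mul, one_mul]
      have e4 : q ^ ((n : ℤ) + 1 - r) = q ^ (n + 1) / q ^ r := by
        rw [zpow_sub₀ hq0]; norm_cast
      have e5 : q ^ ((n : ℤ) + 1 + r) = q ^ (n + 1) * q ^ r := by
        rw [zpow_add₀ hq0]; norm_cast
      have hr := one_sub_zpow_mul_ne_zero hx r
      have hqr := zpow_ne_zero r hq0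
      rw [e1, e2, e4, e5, ← e3]
      push_cast
      field_simp
      ring

theorem norm_partialFraction_le (f : ℤ → ℂ) (n : ℕ) {C : ℝ}
    (hC0 : 0 < C) (hC : ∀ n, ‖invPoch q n‖ ≤ C) (x : ℂ) (r : ℤ) :
    ‖f r * (invPoch q (n - r) * invPoch q (n + r)) / (1 - q ^ r * x)‖ ≤
      ‖f r / (1 - q ^ r * x)‖ * (C * C) := by
  rw [mul_div_right_comm, norm_mul, norm_mul]
  gcongr <;> apply hC

/-- The limit `n → ∞` of the finite partial fraction expansion, by dominated convergence. -/
theorem hasSum_reciprocal (hq0 : q ≠ 0) (hq1 : ‖q‖ < 1) {x : ℂ} (hx0 : x ≠ 0)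
    (hx : ∀ k : ℤ, x ≠ q ^ k) :
    HasSum (fun r : ℤ => thetaTerm q q r / (1 - q ^ r * x)) (qPochInf q q ^ 3 / jTheta x q) := by
  have hE := qPochInf_self_ne_zero hq1
  have hj := jTheta_ne_zero hq1 hx0 hx
  obtain ⟨C, hC0, hC⟩ := exists_norm_invPoch_le hq1
  have hs := summable_norm_div_one_sub hq0 hq1 hx0 hx (summable_norm_thetaTerm hq0 hq1 hq0)
  have h1 : Tendsto (fun n : ℕ => ∑' r : ℤ,
      thetaTerm q q r * (invPoch q (n - r) * invPoch q (n + r)) / (1 - q ^ r * x)) atTop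
      (𝓝 (∑' r : ℤ, thetaTerm q q r * ((qPochInf q q)⁻¹ * (qPochInf q q)⁻¹) /
        (1 - q ^ r * x))) := by
    refine tendsto_tsum_of_dominated_convergence (hs.mul_right (C * C)) (fun r => ?_)
      (Eventually.of_forall fun n r => norm_partialFraction_le _ n hC0 hC x r)
    exact (tendsto_const_nhds.mul (((tendsto_invPoch hq1).comp
        (tendsto_atTop_add_const_right _ _ tendsto_natCast_atTop_atTop)).mul
        ((tendsto_invPoch hq1).comp
        (tendsto_atTop_add_const_right _ _ tendsto_natCast_atTop_atTop)))).div_const _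
  have h2 : Tendsto (fun n : ℕ => 1 / (qPoch x q (n + 1) * qPoch (q / x) q n)) atTop
      (𝓝 (1 / (qPochInf x q * qPochInf (q / x) q))) := by
    refine tendsto_const_nhds.div (((tendsto_qPoch x hq1).comp (tendsto_add_atTop_nat 1)).mul
      (tendsto_qPoch _ hq1)) ?_
    exact left_ne_zero_of_mul hj
  have h3 := tendsto_nhds_unique h1 (h2.congr fun n =>
    (hasSum_partialFraction hq0 hq1 hx0 hx n).tsum_eq.symm)
  refine hasSum_of_eq hs.of_norm.hasSum (fun _ => rfl) ?_
  simp_rw [mul_div_right_comm, tsum_mul_right] at h3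
  have h4 : ∑' r : ℤ, thetaTerm q q r / (1 - q ^ r * x) =
      1 / (qPochInf x q * qPochInf (q / x) q) * (qPochInf q q * qPochInf q q) := by
    rw [← h3, mul_assoc, ← mul_inv, inv_mul_cancel₀ (mul_ne_zero hE hE), mul_one]
  rw [h4]
  unfold jTheta at hj ⊢
  have h5 := left_ne_zero_of_mul (left_ne_zero_of_mul hj)
  have h6 := right_ne_zero_of_mul (left_ne_zero_of_mul hj)
  field_simp

/-! ### Cauchy's identity and the Appell form of the mock theta series. -/

theorem norm_invPoch_mul_le {C : ℝ} (hC0 : 0 < C) (hC : ∀ n, ‖invPoch q n‖ ≤ C) (hq1 : ‖q‖ < 1)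
    {e m : ℕ} (hem : m ≤ e) (a b : ℤ) :
    ‖q ^ e * (invPoch q a * invPoch q b)‖ ≤ ‖q‖ ^ m * (C * C) := by
  rw [norm_mul, norm_mul, norm_pow]
  have h : ‖q‖ ^ e ≤ ‖q‖ ^ m := pow_le_pow_of_le_one (norm_nonneg _) hq1.le hem
  gcongr <;> apply hC

theorem summable_cauchyTerm (hq1 : ‖q‖ < 1) (N : ℕ) :
    Summable (fun m : ℕ => q ^ (m * m + m * N) * (invPoch q m * invPoch q (m + N))) := by
  obtain ⟨C, hC0, hC⟩ := exists_norm_invPoch_le hq1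
  exact ((summable_geometric_of_lt_one (norm_nonneg q) hq1).mul_right (C * C)).of_norm_bounded
    fun m => norm_invPoch_mul_le hC0 hC hq1 (by nlinarith [Nat.le_mul_self m]) _ _

/-- Only the term `m = 0` survives, since the others carry the factor `q ^ (m * N)`. -/
theorem tendsto_cauchySum (hq1 : ‖q‖ < 1) :
    Tendsto (fun N : ℕ => ∑' m : ℕ, q ^ (m * m + m * N) * (invPoch q m * invPoch q (m + N)))
      atTop (𝓝 (qPochInf q q)⁻¹) := by
  obtain ⟨C, hC0, hC⟩ := exists_norm_invPoch_le hq1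
  have h := tendsto_tsum_of_dominated_convergence (𝓕 := atTop)
    (f := fun (N m : ℕ) => q ^ (m * m + m * N) * (invPoch q m * invPoch q (m + N)))
    (g := fun m => if m = 0 then (qPochInf q q)⁻¹ else 0)
    ((summable_geometric_of_lt_one (norm_nonneg q) hq1).mul_right (C * C)) (fun m => ?_)
    (Eventually.of_forall fun N m =>
      norm_invPoch_mul_le hC0 hC hq1 (by nlinarith [Nat.le_mul_self m]) _ _)
  · rwa [tsum_ite_eq] at h
  · have h1 : Tendsto (fun N : ℕ => invPoch q (m + N)) atTop (𝓝 (qPochInf q q)⁻¹) :=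
      (tendsto_invPoch hq1).comp
        (tendsto_atTop_add_const_left _ _ tendsto_natCast_atTop_atTop)
    rcases eq_or_ne m 0 with rfl | hm
    · simpa [invPoch] using h1
    · rw [if_neg hm]
      have h2 : Tendsto (fun N : ℕ => q ^ (m * m) * (q ^ m) ^ N) atTop (𝓝 (q ^ (m * m) * 0)) := by
        refine (tendsto_pow_atTop_nhds_zero_of_norm_lt_one ?_).const_mul _
        rw [norm_pow]
        exact pow_lt_one₀ (norm_nonneg _) hq1 hm
      have h3 := h2.mul (h1.const_mul (invPoch q m))
      rw [mul_zero, zero_mul] at h3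
      refine h3.congr fun N => ?_
      rw [pow_add, pow_mul q m N]

/-- Cauchy's identity. -/
theorem hasSum_cauchy (hq0 : q ≠ 0) (hq1 : ‖q‖ < 1) (N : ℕ) :
    HasSum (fun m : ℕ => q ^ (m * m + m * N) * (invPoch q m * invPoch q (m + N)))
      (qPochInf q q)⁻¹ := by
  set t : ℕ → ℕ → ℂ := fun N m => q ^ (m * m + m * N) * (invPoch q m * invPoch q (m + N)) with ht
  set W : ℕ → ℂ := fun N => ∑' m, t N m with hW
  have hs (N : ℕ) : Summable (t N) := summable_cauchyTerm hq1 N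
  have hlim : Tendsto W atTop (𝓝 (qPochInf q q)⁻¹) := tendsto_cauchySum hq1
  have hrec (N : ℕ) : W N - W (N + 1) = -q ^ (N + 1) * (W (N + 1) - W (N + 2)) := by
    have h1 : HasSum (fun m => t N m - t (N + 1) m + q ^ (N + 1) * t (N + 1) m)
        (W N - W (N + 1) + q ^ (N + 1) * W (N + 1)) :=
      ((hs N).hasSum.sub (hs (N + 1)).hasSum).add ((hs (N + 1)).hasSum.mul_left _)
    rw [← hasSum_nat_add_iff' 1] at h1
    have h2 := h1.unique (hasSum_of_eq ((hs (N + 2)).hasSum.mul_left (q ^ (N + 1)))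
      (fun m => ?_) rfl)
    · have h3 : t N 0 - t (N + 1) 0 + q ^ (N + 1) * t (N + 1) 0 = 0 := by
        have := invPoch_sub_one hq1 ((N + 1 : ℕ) : ℤ)
        rw [show ((N + 1 : ℕ) : ℤ) - 1 = N by push_cast; ring, zpow_natCast] at this
        simp only [ht, Nat.cast_zero, zero_add, zero_mul, pow_zero, one_mul, this]
        ring
      rw [Finset.sum_range_one, h3] at h2
      linear_combination h2
    · have e1 := invPoch_sub_one hq1 ((m + 1 : ℕ) + (N + 1 : ℕ) : ℤ)
      have e2 := invPoch_sub_one hq1 ((m + 1 : ℕ) : ℤ)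
      rw [show ((m + 1 : ℕ) : ℤ) + (N + 1 : ℕ) - 1 = (m + 1 : ℕ) + N by push_cast; ring] at e1
      rw [show ((m + 1 : ℕ) : ℤ) - 1 = m by push_cast; ring, zpow_natCast] at e2
      have e3 : ((m + 1 : ℕ) : ℤ) + (N + 1 : ℕ) = m + (N + 2 : ℕ) := by push_cast; ring
      simp only [ht]
      rw [e1, e2, ← e3, zpow_add₀ hq0, zpow_natCast, zpow_natCast]
      ring
  -- By `hrec` the differences grow in norm with `N`, yet they tend to zero, so all of them vanish.
  have hd (N : ℕ) : W N - W (N + 1) = 0 := by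
    have hmono : Monotone fun N => ‖W N - W (N + 1)‖ := monotone_nat_of_le_succ fun N => by
      rw [hrec, norm_mul, norm_neg, norm_pow]
      exact mul_le_of_le_one_left (norm_nonneg _) (pow_le_one₀ (norm_nonneg _) hq1.le)
    have h0 := (hlim.sub (hlim.comp (tendsto_add_atTop_nat 1))).norm
    rw [sub_self, norm_zero] at h0
    exact norm_le_zero_iff.1 (hmono.ge_of_tendsto h0 N)
  have hc (M : ℕ) : W M = W 0 := by
    induction M with
    | zero => rfl
    | succ M ih => rw [← ih, eq_comm, ← sub_eq_zero, hd]
  have h5 : W N = (qPochInf q q)⁻¹ := by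
    rw [hc]
    exact tendsto_nhds_unique (tendsto_const_nhds.congr fun M => (hc M).symm) hlim
  rw [← h5]
  exact (hs N).hasSum

/-- The terms with `n < |r|` vanish; the shift `n = m + |r|` gives Cauchy's identity with `N =
2|r|`. -/
theorem hasSum_cauchy_int (hq0 : q ≠ 0) (hq1 : ‖q‖ < 1) (r : ℤ) :
    HasSum (fun n : ℕ => q ^ (n ^ 2) * (invPoch q (n - r) * invPoch q (n + r)))
      (q ^ (r ^ 2) * (qPochInf q q)⁻¹) := by
  have main (k : ℕ) : HasSum (fun n : ℕ => q ^ (n ^ 2) * (invPoch q (n - k) * invPoch q (n + k)))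
      (q ^ (k ^ 2) * (qPochInf q q)⁻¹) := by
    rw [← hasSum_nat_add_iff' k, Finset.sum_eq_zero, sub_zero]
    · refine hasSum_of_eq ((hasSum_cauchy hq0 hq1 (2 * k)).mul_left (q ^ (k ^ 2))) (fun n => ?_) rfl
      rw [show ((n + k : ℕ) : ℤ) - k = n by push_cast; ring,
        show ((n + k : ℕ) : ℤ) + k = n + (2 * k : ℕ) by push_cast; ring]
      ring
    · intro n hn
      rw [invPoch_of_neg q (n := (n : ℤ) - k) (by have := Finset.mem_range.1 hn; omega)]
      simp
  obtain ⟨k, rfl | rfl⟩ := Int.eq_nat_or_neg r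
  · exact hasSum_of_eq (main k) (fun n => rfl) (by norm_cast)
  · refine hasSum_of_eq (main k) (fun n => ?_) (by rw [neg_sq]; norm_cast)
    rw [sub_neg_eq_add, ← sub_eq_add_neg, mul_comm (invPoch q (n + k))]

/-- The Appell-Lerch form of the series defining the universal mock theta function. -/
theorem hasSum_mockGTerm (hq0 : q ≠ 0) (hq1 : ‖q‖ < 1) {x : ℂ} (hx0 : x ≠ 0)
    (hx : ∀ k : ℤ, x ≠ q ^ k) :
    HasSum (mockGTerm x q) ((qPochInf q q)⁻¹ *
      ∑' r : ℤ, thetaTerm q q r * q ^ (r ^ 2) / (1 - q ^ r * x)) := by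
  obtain ⟨C, hC0, hC⟩ := exists_norm_invPoch_le hq1
  set F : ℕ × ℤ → ℂ := fun p => q ^ (p.1 ^ 2) * (thetaTerm q q p.2 *
    (invPoch q (p.1 - p.2) * invPoch q (p.1 + p.2)) / (1 - q ^ p.2 * x)) with hF
  have hs : Summable F := by
    have h1 := summable_norm_div_one_sub hq0 hq1 hx0 hx (summable_norm_thetaTerm hq0 hq1 hq0)
    have h2 := (summable_geometric_of_lt_one (norm_nonneg q) hq1).mul_of_nonneg
      (h1.mul_right (C * C)) (fun n => by positivity) (fun r => by positivity)
    refine h2.of_norm_bounded fun p => ?_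
    rw [hF, norm_mul, norm_pow]
    have h3 : ‖q‖ ^ (p.1 ^ 2) ≤ ‖q‖ ^ p.1 :=
      pow_le_pow_of_le_one (norm_nonneg _) hq1.le (by nlinarith [Nat.le_mul_self p.1])
    have h4 := norm_partialFraction_le (thetaTerm q q) p.1 hC0 hC x p.2
    exact mul_le_mul h3 h4 (norm_nonneg _) (by positivity)
  have h1 : HasSum (mockGTerm x q) (∑' p, F p) := by
    refine hasSum_of_eq (hs.hasSum.prod_fiberwise fun n =>
      (hasSum_partialFraction hq0 hq1 hx0 hx n).mul_left (q ^ (n ^ 2))) (fun n => ?_) rfl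
    rw [mockGTerm, mul_one_div]
  have h2 : HasSum (fun r : ℤ => thetaTerm q q r / (1 - q ^ r * x) *
      (q ^ (r ^ 2) * (qPochInf q q)⁻¹)) (∑' p, F p) := by
    have h3 : HasSum (F ∘ Prod.swap) (∑' p, F p) := (Equiv.prodComm ℤ ℕ).hasSum_iff.2 hs.hasSum
    refine h3.prod_fiberwise fun r => hasSum_of_eq ((hasSum_cauchy_int hq0 hq1 r).mul_left
      (thetaTerm q q r / (1 - q ^ r * x))) (fun n => ?_) rfl
    simp only [hF, Function.comp, Prod.swap]
    ring
  refine hasSum_of_eq h1 (fun _ => rfl) ?_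
  rw [← h2.tsum_eq, ← tsum_mul_left]
  exact tsum_congr fun r => by ring

/-! ### Series of Gaussian binomials as partial theta series. -/

/-- The Gaussian binomial coefficient `[2n + N, n]`. -/
noncomputable def centralBinom (q : ℂ) (N n : ℕ) : ℂ :=
  qPoch q q (2 * n + N) * (invPoch q n * invPoch q (n + N : ℕ))

theorem centralBinom_zero (hq1 : ‖q‖ < 1) (N : ℕ) : centralBinom q N 0 = 1 := by
  have := qPoch_self_ne_zero hq1 N
  simp only [centralBinom, invPoch_natCast, mul_zero, zero_add, qPoch_zero, inv_one, one_mul]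
  exact mul_inv_cancel₀ this

theorem invPoch_eq_mul_succ (hq1 : ‖q‖ < 1) (n : ℕ) :
    invPoch q n = (1 - q ^ (n + 1)) * invPoch q (n + 1 : ℕ) := by
  have := invPoch_sub_one hq1 ((n + 1 : ℕ) : ℤ)
  rwa [show ((n + 1 : ℕ) : ℤ) - 1 = n by push_cast; ring, zpow_natCast] at this

theorem centralBinom_pascal (hq1 : ‖q‖ < 1) (N n : ℕ) :
    centralBinom q (N + 1) (n + 1) =
      centralBinom q N (n + 1) + q ^ (n + N + 2) * centralBinom q (N + 2) n := by
  unfold centralBinom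
  rw [show 2 * (n + 1) + (N + 1) = 2 * n + (N + 2) + 1 by ring,
    show 2 * (n + 1) + N = 2 * n + (N + 2) by ring, qPoch_succ, invPoch_eq_mul_succ hq1 n,
    show n + 1 + N = n + N + 1 by ring, invPoch_eq_mul_succ hq1 (n + N + 1),
    show n + 1 + (N + 1) = n + N + 2 by ring, show n + (N + 2) = n + N + 2 by ring]
  ring

theorem centralBinom_pascal' (hq1 : ‖q‖ < 1) (N n : ℕ) :
    centralBinom q (N + 1) (n + 1) =
      centralBinom q (N + 2) n + q ^ (n + 1) * centralBinom q N (n + 1) := by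
  unfold centralBinom
  rw [show 2 * (n + 1) + (N + 1) = 2 * n + (N + 2) + 1 by ring,
    show 2 * (n + 1) + N = 2 * n + (N + 2) by ring, qPoch_succ, invPoch_eq_mul_succ hq1 n,
    show n + 1 + N = n + N + 1 by ring, invPoch_eq_mul_succ hq1 (n + N + 1),
    show n + 1 + (N + 1) = n + N + 2 by ring, show n + (N + 2) = n + N + 2 by ring]
  ring

theorem exists_norm_centralBinom_le (hq1 : ‖q‖ < 1) :
    ∃ C, 0 < C ∧ ∀ N n, ‖centralBinom q N n‖ ≤ C := by
  obtain ⟨C, hC0, hC⟩ := exists_norm_invPoch_le hq1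
  obtain ⟨D, hD0, hD⟩ := exists_norm_le_of_tendsto (tendsto_qPoch q hq1)
  refine ⟨D * (C * C), by positivity, fun N n => ?_⟩
  rw [centralBinom, norm_mul, norm_mul]
  gcongr
  exacts [hD _, hC _, hC _]

/-- The series `∑ q^n [2n + N, n]`. -/
noncomputable def binomSum (q : ℂ) (N : ℕ) : ℂ := ∑' n : ℕ, q ^ n * centralBinom q N n

theorem summable_pow_mul_centralBinom (hq1 : ‖q‖ < 1) (N : ℕ) {p : ℂ} (hp : ‖p‖ < 1) :
    Summable (fun n : ℕ => p ^ n * centralBinom q N n) := by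
  obtain ⟨C, hC0, hC⟩ := exists_norm_centralBinom_le hq1
  refine ((summable_geometric_of_lt_one (norm_nonneg p) hp).mul_right C).of_norm_bounded
    fun n => ?_
  rw [norm_mul, norm_pow]
  gcongr
  exact hC _ _

/-- Each of the two `q`-Pascal rules relates `binomSum` to the same series with `q ^ 2` in place of
`q` in the weight; eliminating that series shows that `binomSum q N + q ^ (N + 3) * binomSum q (N +
3)` does not depend on `N`. -/
theorem binomSum_rec (hq1 : ‖q‖ < 1) (N : ℕ) :
    binomSum q N + q ^ (N + 3) * binomSum q (N + 3) =
      binomSum q (N + 1) + q ^ (N + 4) * binomSum q (N + 4) := by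
  have hq2 : ‖q ^ 2‖ < 1 := by rw [norm_pow]; exact pow_lt_one₀ (norm_nonneg _) hq1 two_ne_zero
  have hS (N : ℕ) : HasSum (fun n : ℕ => q ^ n * centralBinom q N n) (binomSum q N) :=
    (summable_pow_mul_centralBinom hq1 N hq1).hasSum
  have hT (N : ℕ) := (summable_pow_mul_centralBinom hq1 N hq2).hasSum
  have h1 (N : ℕ) : binomSum q (N + 1) - binomSum q N =
      q ^ (N + 3) * ∑' n : ℕ, (q ^ 2) ^ n * centralBinom q (N + 2) n := by
    have h := (hasSum_nat_add_iff' 1).2 ((hS (N + 1)).sub (hS N))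
    simp only [Finset.sum_range_one, centralBinom_zero hq1, sub_self, sub_zero] at h
    refine h.unique (hasSum_of_eq ((hT (N + 2)).mul_left _) (fun n => ?_) rfl)
    rw [centralBinom_pascal hq1]
    ring
  have h2 (N : ℕ) : binomSum q (N + 1) - ∑' n : ℕ, (q ^ 2) ^ n * centralBinom q N n =
      q * binomSum q (N + 2) := by
    have h := (hasSum_nat_add_iff' 1).2 ((hS (N + 1)).sub (hT N))
    simp only [Finset.sum_range_one, centralBinom_zero hq1, pow_zero, sub_self, sub_zero] at h
    refine h.unique (hasSum_of_eq ((hS (N + 2)).mul_left _) (fun n => ?_) rfl)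
    rw [centralBinom_pascal' hq1]
    ring
  linear_combination -h1 N + q ^ (N + 3) * h2 (N + 2)

/-- Euler's identity. -/
theorem hasSum_pow_mul_invPoch (hq1 : ‖q‖ < 1) :
    HasSum (fun n : ℕ => q ^ n * invPoch q n) (qPochInf q q)⁻¹ := by
  obtain ⟨C, hC0, hC⟩ := exists_norm_invPoch_le hq1
  have hs : Summable (fun n : ℕ => q ^ n * invPoch q n) := by
    refine ((summable_geometric_of_lt_one (norm_nonneg q) hq1).mul_right C).of_norm_bounded
      fun n => ?_
    rw [norm_mul, norm_pow]
    gcongr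
    exact hC _
  have h (M : ℕ) : ∑ n ∈ Finset.range (M + 1), q ^ n * invPoch q n = invPoch q M := by
    induction M with
    | zero => simp [invPoch]
    | succ M ih =>
      rw [Finset.sum_range_succ, ih, invPoch_eq_mul_succ hq1]
      ring
  have h1 := hs.hasSum.tendsto_sum_nat.comp (tendsto_add_atTop_nat 1)
  have h2 := tendsto_nhds_unique h1
    ((tendsto_invPoch_natCast hq1).congr fun M => (h M).symm)
  rw [← h2]
  exact hs.hasSum

theorem tendsto_binomSum (hq1 : ‖q‖ < 1) :
    Tendsto (binomSum q) atTop (𝓝 (qPochInf q q)⁻¹) := by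
  obtain ⟨C, hC0, hC⟩ := exists_norm_centralBinom_le hq1
  rw [← (hasSum_pow_mul_invPoch hq1).tsum_eq]
  refine tendsto_tsum_of_dominated_convergence
    ((summable_geometric_of_lt_one (norm_nonneg q) hq1).mul_right C) (fun n => ?_)
    (Eventually.of_forall fun N n => ?_)
  · have h1 : Tendsto (fun N => qPoch q q (2 * n + N)) atTop (𝓝 (qPochInf q q)) :=
      (tendsto_qPoch q hq1).comp
        (tendsto_atTop_mono (fun M => Nat.le_add_left M _) tendsto_id)
    have h2 : Tendsto (fun N => invPoch q (n + N : ℕ)) atTop (𝓝 (qPochInf q q)⁻¹) :=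
      (tendsto_invPoch_natCast hq1).comp (tendsto_atTop_mono (fun M => Nat.le_add_left M _) tendsto_id)
    have h3 : q ^ n * invPoch q n =
        q ^ n * (qPochInf q q * (invPoch q n * (qPochInf q q)⁻¹)) := by
      rw [mul_left_comm (qPochInf q q), mul_inv_cancel₀ (qPochInf_self_ne_zero hq1), mul_one]
    rw [h3]
    exact (h1.mul (h2.const_mul (invPoch q n))).const_mul (q ^ n)
  · rw [norm_mul, norm_pow]
    gcongr
    exact hC _ _

theorem binomSum_eq (hq1 : ‖q‖ < 1) (N : ℕ) :
    binomSum q N + q ^ (N + 3) * binomSum q (N + 3) = (qPochInf q q)⁻¹ := by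
  have hc (M : ℕ) : binomSum q (N + M) + q ^ (N + M + 3) * binomSum q (N + M + 3) =
      binomSum q N + q ^ (N + 3) * binomSum q (N + 3) := by
    induction M with
    | zero => rfl
    | succ M ih =>
      rw [← ih]
      exact (binomSum_rec hq1 (N + M)).symm
  have h1 : Tendsto (fun M => binomSum q (N + M)) atTop (𝓝 (qPochInf q q)⁻¹) :=
    (tendsto_binomSum hq1).comp (tendsto_atTop_mono (fun M => Nat.le_add_left M _) tendsto_id)
  have h2 : Tendsto (fun M => q ^ (N + M)) atTop (𝓝 0) :=
    (tendsto_pow_atTop_nhds_zero_of_norm_lt_one hq1).comp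
      (tendsto_atTop_mono (fun M => Nat.le_add_left M _) tendsto_id)
  have h3 := h1.add ((h2.comp (tendsto_add_atTop_nat 3)).mul (h1.comp (tendsto_add_atTop_nat 3)))
  rw [zero_mul, add_zero] at h3
  exact tendsto_nhds_unique (tendsto_const_nhds.congr fun M => (hc M).symm) h3

theorem norm_thetaTerm_self_le_one (hq0 : q ≠ 0) (hq1 : ‖q‖ < 1) (j : ℕ) :
    ‖thetaTerm q q j‖ ≤ 1 := by
  induction j with
  | zero => simp
  | succ j ih =>
    push_cast
    rw [thetaTerm_add_one hq0 hq0, norm_mul, norm_neg, norm_mul, zpow_natCast, norm_pow]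
    exact mul_le_one₀ (mul_le_one₀ (pow_le_one₀ (norm_nonneg _) hq1.le) (norm_nonneg _) hq1.le)
      (norm_nonneg _) ih

/-- Iterating `binomSum_eq` in steps `N → N + 3` produces the partial sums; the remainder tends to
zero. -/
theorem hasSum_binomSum (hq0 : q ≠ 0) (hq1 : ‖q‖ < 1) (N : ℕ) :
    HasSum (fun j : ℕ => thetaTerm q q j * q ^ (j * (j + 1) + j * N))
      (qPochInf q q * binomSum q N) := by
  have hE := qPochInf_self_ne_zero hq1
  have hb (j : ℕ) : ‖thetaTerm q q j * q ^ (j * (j + 1) + j * N)‖ ≤ ‖q‖ ^ j := by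
    rw [norm_mul, norm_pow]
    refine (mul_le_of_le_one_left (by positivity) (norm_thetaTerm_self_le_one hq0 hq1 j)).trans ?_
    exact pow_le_pow_of_le_one (norm_nonneg _) hq1.le (by nlinarith [Nat.zero_le (j * N)])
  have hs : Summable (fun j : ℕ => thetaTerm q q j * q ^ (j * (j + 1) + j * N)) :=
    (summable_geometric_of_lt_one (norm_nonneg q) hq1).of_norm_bounded hb
  have h (J : ℕ) : ∑ j ∈ Finset.range J, thetaTerm q q j * q ^ (j * (j + 1) + j * N) =
      qPochInf q q * binomSum q N - thetaTerm q q J * q ^ (J * (J + 1) + J * N) *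
        (qPochInf q q * binomSum q (N + 3 * J)) := by
    induction J with
    | zero => simp
    | succ J ih =>
      have h1 := binomSum_eq hq1 (N + 3 * J)
      have h2 : qPochInf q q * binomSum q (N + 3 * J) =
          1 - q ^ (N + 3 * J + 3) * (qPochInf q q * binomSum q (N + 3 * J + 3)) := by
        field_simp at h1
        linear_combination h1
      rw [Finset.sum_range_succ, ih, h2]
      push_cast
      rw [thetaTerm_add_one hq0 hq0, zpow_natCast, show N + 3 * (J + 1) = N + 3 * J + 3 by ring]
      ring
  have h0 : Tendsto (fun J : ℕ => thetaTerm q q J * q ^ (J * (J + 1) + J * N)) atTop (𝓝 0) :=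
    squeeze_zero_norm hb (tendsto_pow_atTop_nhds_zero_of_lt_one (norm_nonneg q) hq1)
  have h1 : Tendsto (fun J : ℕ => binomSum q (N + 3 * J)) atTop (𝓝 (qPochInf q q)⁻¹) :=
    (tendsto_binomSum hq1).comp (tendsto_atTop_mono (fun J => show J ≤ N + 3 * J by omega) tendsto_id)
  have h2 := (h0.mul (h1.const_mul (qPochInf q q))).const_sub (qPochInf q q * binomSum q N)
  rw [zero_mul, sub_zero] at h2
  rw [← tendsto_nhds_unique hs.hasSum.tendsto_sum_nat (h2.congr fun J => (h J).symm)]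
  exact hs.hasSum

/-! ### The dual series as a difference of two bilateral series. -/

theorem qPoch_mul_invPoch (hq1 : ‖q‖ < 1) (n : ℕ) : qPoch q q n * invPoch q n = 1 := by
  rw [invPoch_natCast, mul_inv_cancel₀ (qPoch_self_ne_zero hq1 n)]

theorem hasSum_dual_coeff (hq1 : ‖q‖ < 1) (k : ℕ) :
    HasSum (fun m : ℕ => q ^ (m + 1) * (qPoch q q (2 * m + 1) *
      (invPoch q (m + (k + 1)) * invPoch q (m - k)))) (q ^ (k + 1) * binomSum q (2 * k + 1)) := by
  rw [← hasSum_nat_add_iff' k, Finset.sum_eq_zero, sub_zero]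
  · refine hasSum_of_eq ((summable_pow_mul_centralBinom hq1 (2 * k + 1) hq1).hasSum.mul_left
      (q ^ (k + 1))) (fun n => ?_) rfl
    rw [centralBinom, show ((n + k : ℕ) : ℤ) - k = n by push_cast; ring,
      show ((n + k : ℕ) : ℤ) + (k + 1) = (n + (2 * k + 1) : ℕ) by push_cast; ring,
      show 2 * (n + k) + 1 = 2 * n + (2 * k + 1) by ring]
    ring
  · intro n hn
    rw [invPoch_of_neg q (n := (n : ℤ) - k) (by have := Finset.mem_range.1 hn; omega)]
    simp

/-- The powers `x ^ (-k)` and `x ^ (k + 1)` in the finite triple product have the same pair of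
reciprocal Pochhammer factors. Hence they share the coefficient from `hasSum_dual_coeff` once the
sums over `m` and the theta index are exchanged. -/
theorem hasSum_dual_aux (hq0 : q ≠ 0) (hq1 : ‖q‖ < 1) {x : ℂ} (hx : x ≠ 0) :
    ∃ D, HasSum (fun m : ℕ => q ^ (m + 1) * (qPoch (q / x) q m * qPoch x q (m + 1))) D ∧
      HasSum (fun k : ℕ => thetaTerm q q (k + 1 : ℕ) * (x ^ (k + 1) - x⁻¹ ^ k) *
        binomSum q (2 * k + 1)) D := by
  obtain ⟨C, hC0, hC⟩ := exists_norm_invPoch_le hq1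
  obtain ⟨P, hP0, hP⟩ := exists_norm_le_of_tendsto (tendsto_qPoch q hq1)
  set F : ℕ × ℤ → ℂ := fun p => q ^ (p.1 + 1) * qPoch q q (2 * p.1 + 1) *
    (thetaTerm q x p.2 * (invPoch q (p.1 + p.2) * invPoch q (p.1 + 1 - p.2))) with hF
  have hs : Summable F := by
    have h2 := (summable_geometric_of_lt_one (norm_nonneg q) hq1).mul_of_nonneg
      ((summable_norm_thetaTerm hq0 hq1 hx).mul_right (P * (C * C)))
      (fun n => by positivity) (fun r => by positivity)
    refine h2.of_norm_bounded fun p => ?_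
    simp only [hF, norm_mul, norm_pow]
    have h3 : ‖q‖ ^ (p.1 + 1) ≤ ‖q‖ ^ p.1 :=
      pow_le_pow_of_le_one (norm_nonneg _) hq1.le (Nat.le_succ _)
    calc _ ≤ ‖q‖ ^ p.1 * P * (‖thetaTerm q x p.2‖ * (C * C)) := by
          gcongr
          exacts [hP _, hC _, hC _]
      _ = _ := by ring
  refine ⟨∑' p, F p, ?_, ?_⟩
  · refine hasSum_of_eq (hs.hasSum.prod_fiberwise fun m => hasSum_of_eq
      ((hasSum_finite_tripleProduct hq0 hq1 hx m (m + 1)).mul_left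
      (q ^ (m + 1) * qPoch q q (2 * m + 1))) (fun r => ?_) rfl) (fun m => ?_) rfl
    · simp only [hF]
      push_cast
      rfl
    · have h := qPoch_mul_invPoch hq1 (2 * m + 1)
      rw [show ((2 * m + 1 : ℕ) : ℤ) = m + (m + 1 : ℕ) by push_cast; ring] at h
      linear_combination (-1) * q ^ (m + 1) * (qPoch (q / x) q m * qPoch x q (m + 1)) * h
  · have h3 : HasSum (F ∘ Prod.swap) (∑' p, F p) := (Equiv.prodComm ℤ ℕ).hasSum_iff.2 hs.hasSum
    have h4 (r : ℤ) : Summable fun m : ℕ => F (m, r) := hs.comp_injective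
      (Prod.mk_left_injective r)
    have h5 := h3.prod_fiberwise fun r => (h4 r).hasSum
    have h6 := ((Equiv.neg ℤ).hasSum_iff.2 h5).nat_add_neg_add_one
    refine hasSum_of_eq h6 (fun k => ?_) rfl
    have e1 : HasSum (fun m : ℕ => F (m, -(k : ℤ)))
        (thetaTerm q x (-k) * (q ^ (k + 1) * binomSum q (2 * k + 1))) := by
      refine hasSum_of_eq ((hasSum_dual_coeff hq1 k).mul_left _) (fun m => ?_) rfl
      simp only [hF]
      rw [← sub_eq_add_neg, show (m : ℤ) + 1 - -k = m + (k + 1) by ring]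
      ring
    have e2 : HasSum (fun m : ℕ => F (m, (k : ℤ) + 1))
        (thetaTerm q x (k + 1) * (q ^ (k + 1) * binomSum q (2 * k + 1))) := by
      refine hasSum_of_eq ((hasSum_dual_coeff hq1 k).mul_left _) (fun m => ?_) rfl
      simp only [hF]
      rw [show (m : ℤ) + 1 - (k + 1) = m - k by ring]
      ring
    simp only [Function.comp, Equiv.neg_apply, neg_neg]
    rw [e1.tsum_eq, e2.tsum_eq, thetaTerm_neg hq0 hx, div_eq_mul_inv, thetaTerm_mul]
    have e3 : thetaTerm q q (k + 1 : ℕ) = thetaTerm q x (k + 1) * q ^ (k + 1) * x⁻¹ ^ (k + 1) := by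
      have h1 := thetaTerm_mul q x q (k + 1 : ℕ)
      rw [mul_comm x, thetaTerm_mul] at h1
      push_cast at h1 ⊢
      norm_cast at h1 ⊢
      rw [inv_pow, ← div_eq_mul_inv, eq_div_iff (pow_ne_zero _ hx), h1]
    have e4 : thetaTerm q q (k + 1 : ℕ) = -(q ^ k * q) * thetaTerm q q k := by
      push_cast
      rw [thetaTerm_add_one hq0 hq0, zpow_natCast]
    have e5 : x⁻¹ ^ (k + 1) * x ^ (k + 1) = 1 := by rw [← mul_pow, inv_mul_cancel₀ hx, one_pow]
    rw [zpow_natCast, mul_sub, sub_mul]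
    rw [show thetaTerm q q (k + 1 : ℕ) * x ^ (k + 1) = thetaTerm q x (k + 1) * q ^ (k + 1) by
      rw [e3, mul_assoc, e5, mul_one], e4]
    ring

theorem norm_pow_le_pow_of_le (hq1 : ‖q‖ < 1) {m n : ℕ} (h : m ≤ n) : ‖q ^ n‖ ≤ ‖q‖ ^ m := by
  rw [norm_pow]
  exact pow_le_pow_of_le_one (norm_nonneg _) hq1.le h

/-- With `s = k + j` the exponent splits as `j(j+1) + j(2k+1) = j(k+1) + j(s+1)`. The first part is
the cross term that merges the two theta terms into one of index `s + 1`. -/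
theorem hasSum_dual_rearranged (hq0 : q ≠ 0) (hq1 : ‖q‖ < 1) {x D : ℂ} (hx : x ≠ 0)
    (hD : HasSum (fun k : ℕ => thetaTerm q q (k + 1 : ℕ) * (x ^ (k + 1) - x⁻¹ ^ k) *
        binomSum q (2 * k + 1)) D) :
    HasSum (fun s : ℕ => thetaTerm q q (s + 1 : ℕ) *
      ∑ p ∈ Finset.HasAntidiagonal.antidiagonal s, (x ^ (p.1 + 1) - x⁻¹ ^ p.1) * q ^ (p.2 * (s + 1)))
      (qPochInf q q * D) := by
  set G : ℕ × ℕ → ℂ := fun p => thetaTerm q q (p.1 + 1 : ℕ) * (x ^ (p.1 + 1) - x⁻¹ ^ p.1) *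
    (thetaTerm q q p.2 * q ^ (p.2 * (p.2 + 1) + p.2 * (2 * p.1 + 1))) with hG
  have hs : Summable G := by
    have h1 : Summable fun k : ℕ => ‖thetaTerm q q (k + 1 : ℕ) * (x ^ (k + 1) - x⁻¹ ^ k)‖ := by
      have a1 := (summable_nat_add_iff 1).2 (summable_norm_thetaTerm_nat hq0 hq1 (mul_ne_zero hq0 hx))
      have a2 := (summable_nat_add_iff 1).2
        (summable_norm_thetaTerm_nat hq0 hq1 (mul_ne_zero hq0 (inv_ne_zero hx)))
      refine (a1.add (a2.mul_right ‖x‖)).of_nonneg_of_le (fun _ => norm_nonneg _) fun k => ?_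
      rw [mul_sub, thetaTerm_mul, thetaTerm_mul]
      refine (norm_sub_le _ _).trans (le_of_eq ?_)
      congr 1
      rw [← norm_mul, zpow_natCast, pow_succ _ k, mul_assoc, mul_assoc, inv_mul_cancel₀ hx, mul_one]
    refine (h1.mul_of_nonneg (summable_geometric_of_lt_one (norm_nonneg q) hq1)
      (fun _ => norm_nonneg _) (fun _ => by positivity)).of_norm_bounded fun p => ?_
    rw [hG, norm_mul, norm_mul (thetaTerm q q p.2)]
    refine mul_le_mul_of_nonneg_left ?_ (norm_nonneg _)
    refine (mul_le_of_le_one_left (norm_nonneg _) (norm_thetaTerm_self_le_one hq0 hq1 _)).trans ?_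
    exact norm_pow_le_pow_of_le hq1 (by nlinarith [Nat.zero_le (p.2 * p.2), Nat.zero_le (p.2 * p.1)])
  have h1 : HasSum G (qPochInf q q * D) := by
    refine hasSum_of_eq hs.hasSum (fun _ => rfl) ?_
    refine (hD.mul_left (qPochInf q q)).unique (hasSum_of_eq (hs.hasSum.prod_fiberwise fun k =>
      (hasSum_binomSum hq0 hq1 (2 * k + 1)).mul_left (thetaTerm q q (k + 1 : ℕ) *
        (x ^ (k + 1) - x⁻¹ ^ k))) (fun k => ?_) rfl)
    ring
  have h2 := (Finset.HasAntidiagonal.sigmaAntidiagonalEquivProd.hasSum_iff.2 h1).sigma fun s =>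
    (Finset.HasAntidiagonal.antidiagonal s).hasSum G
  refine hasSum_of_eq h2 (fun s => ?_) rfl
  rw [Finset.mul_sum]
  refine Finset.sum_congr rfl fun p hp => ?_
  have hp := Finset.HasAntidiagonal.mem_antidiagonal.1 hp
  have e : ((s + 1 : ℕ) : ℤ) = (p.1 + 1 : ℕ) + (p.2 : ℤ) := by rw [← hp]; push_cast; ring
  rw [hG, e, thetaTerm_add hq0 hq0, ← hp]
  have e2 : q ^ (((p.1 + 1 : ℕ) : ℤ) * (p.2 : ℤ)) = q ^ ((p.1 + 1) * p.2) := by norm_cast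
  rw [e2]
  ring

theorem hasSum_dual (hq0 : q ≠ 0) (hq1 : ‖q‖ < 1) {x : ℂ} (hx0 : x ≠ 0)
    (hx : ∀ k : ℤ, x ≠ q ^ k) :
    HasSum (fun m : ℕ => q ^ (m + 1) * (qPoch (q / x) q m * qPoch x q (m + 1)))
      (-x * (qPochInf q q)⁻¹ * ((∑' r : ℤ, thetaTerm q (q / x) r / (1 - q ^ r * x)) -
        ∑' r : ℤ, thetaTerm q q r * q ^ (r ^ 2) / (1 - q ^ r * x))) := by
  obtain ⟨D, hD1, hD2⟩ := hasSum_dual_aux hq0 hq1 hx0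
  refine hasSum_of_eq hD1 (fun _ => rfl) ?_
  have hD3 := (hasSum_dual_rearranged hq0 hq1 hx0 hD2).mul_left (-x⁻¹)
  have s1 := (summable_thetaTerm_div hq0 hq1 (div_ne_zero hq0 hx0) hx0 hx).hasSum
  have s2 : Summable (fun r : ℤ => thetaTerm q q r * q ^ (r ^ 2) / (1 - q ^ r * x)) := by
    refine (summable_norm_div_one_sub hq0 hq1 hx0 hx ((summable_norm_thetaTerm hq0 hq1
      hq0).of_nonneg_of_le (fun _ => norm_nonneg _) fun r => ?_)).of_norm
    rw [norm_mul, norm_zpow]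
    refine mul_le_of_le_one_right (norm_nonneg _) ?_
    rw [show r ^ 2 = ((r ^ 2).toNat : ℤ) from (Int.toNat_of_nonneg (sq_nonneg r)).symm,
      zpow_natCast]
    exact pow_le_one₀ (norm_nonneg _) hq1.le
  -- Terms `r` and `-r` are paired. The `r = 0` terms of the two series cancel, so the paired sum
  -- starts at `r = s + 1`, where it matches the geometric sums with ratios `x / Q` and `x⁻¹ / Q`,
  -- `Q = q ^ (s + 1)`.
  have h1 := (hasSum_nat_add_iff' 1).2 (s1.sub s2.hasSum).nat_add_neg
  have h2 := hD3.unique (hasSum_of_eq h1 (fun s => ?_) rfl)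
  · simp only [Finset.sum_range_one, Nat.cast_zero, neg_zero, thetaTerm_zero,
      zero_pow two_ne_zero, zpow_zero, mul_one, sub_self, add_zero, sub_zero] at h2
    have hE := qPochInf_self_ne_zero hq1
    rw [← mul_right_inj' (inv_ne_zero hx0), ← mul_right_inj' (neg_ne_zero.2 hE)]
    have e1 : -qPochInf q q * (x⁻¹ * D) = -x⁻¹ * (qPochInf q q * D) := by ring
    rw [e1, h2]
    field_simp
  · rw [Finset.Nat.sum_antidiagonal_eq_sum_range_succ
      (fun i j => (x ^ (i + 1) - x⁻¹ ^ i) * q ^ (j * (s + 1)))]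
    set Q := q ^ (s + 1) with hQ
    have hQ0 : Q ≠ 0 := pow_ne_zero _ hq0
    have hxQ : x - Q ≠ 0 := by
      intro h
      refine hx (s + 1 : ℕ) ?_
      rw [zpow_natCast]
      exact sub_eq_zero.1 h
    have hQx : 1 - Q * x ≠ 0 := one_sub_zpow_mul_ne_zero hx (s + 1 : ℕ)
    have hxQ' : x⁻¹ - Q ≠ 0 := by
      intro h
      apply hQx
      rw [← sub_eq_zero.1 h, inv_mul_cancel₀ hx0, sub_self]
    have g1 := geom_sum₂_mul x Q (s + 1)
    have g2 := geom_sum₂_mul x⁻¹ Q (s + 1)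
    rw [← eq_div_iff hxQ] at g1
    rw [← eq_div_iff hxQ'] at g2
    have e0 : ∑ k ∈ Finset.range (s + 1), (x ^ (k + 1) - x⁻¹ ^ k) * q ^ ((s - k) * (s + 1)) =
        x * ((x ^ (s + 1) - Q ^ (s + 1)) / (x - Q)) -
          (x⁻¹ ^ (s + 1) - Q ^ (s + 1)) / (x⁻¹ - Q) := by
      rw [← g1, ← g2, Finset.mul_sum, ← Finset.sum_sub_distrib]
      refine Finset.sum_congr rfl fun k _ => ?_
      rw [hQ, mul_comm (s - k), pow_mul, show s + 1 - 1 - k = s - k by omega]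
      ring
    have e1 : thetaTerm q (q / x) (s + 1 : ℕ) = thetaTerm q q (s + 1 : ℕ) * x⁻¹ ^ (s + 1) := by
      rw [div_eq_mul_inv, thetaTerm_mul, zpow_natCast]
    have e2 : thetaTerm q (q / x) (-(s + 1 : ℕ)) =
        thetaTerm q q (s + 1 : ℕ) * (x ^ (s + 1) / Q) := by
      rw [thetaTerm_neg hq0 (div_ne_zero hq0 hx0), div_div_cancel₀ hq0,
        show thetaTerm q x (s + 1 : ℕ) = thetaTerm q (q * (x / q)) (s + 1 : ℕ) by
          rw [mul_div_cancel₀ _ hq0], thetaTerm_mul, zpow_natCast, div_pow]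
    have e3 : thetaTerm q q (-(s + 1 : ℕ)) = thetaTerm q q (s + 1 : ℕ) / Q := by
      rw [thetaTerm_neg hq0 hq0, div_self hq0, show thetaTerm q 1 (s + 1 : ℕ) =
        thetaTerm q (q * q⁻¹) (s + 1 : ℕ) by rw [mul_inv_cancel₀ hq0], thetaTerm_mul,
        zpow_natCast, inv_pow, div_eq_mul_inv]
    have e4 : q ^ (((s + 1 : ℕ) : ℤ) ^ 2) = Q ^ (s + 1) := by
      rw [hQ, ← pow_mul, ← sq]; norm_cast
    have hd : 1 - Q⁻¹ * x ≠ 0 := by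
      intro h
      apply hxQ
      have : Q * (1 - Q⁻¹ * x) = Q - x := by field_simp
      rw [h, mul_zero] at this
      linear_combination this
    rw [e0, e1, e2, e3, neg_sq, e4, zpow_neg, zpow_natCast, ← hQ]
    have f1 : (x⁻¹ ^ (s + 1) - Q ^ (s + 1)) / (x⁻¹ - Q) =
        x * ((x⁻¹ ^ (s + 1) - Q ^ (s + 1)) / (1 - Q * x)) := by
      have : x⁻¹ - Q = x⁻¹ * (1 - Q * x) := by field_simp
      rw [this]
      field_simp
    have f2 : (1 - Q⁻¹ * x) = -(x - Q) * Q⁻¹ := by field_simp; ring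
    rw [f1, f2]
    generalize x⁻¹ ^ (s + 1) = A
    field_simp
    ring

/-! ### Convergence statements and the identity with `z = -a⁻¹`. -/

theorem appellLerchTerm_eq (hq0 : q ≠ 0) (x z : ℂ) (r : ℤ) :
    appellLerchTerm x q z r = thetaTerm q z r / (1 - q ^ r * (x * z / q)) := by
  rw [appellLerchTerm, thetaTerm, zpow_sub_one₀ hq0]
  congr 2
  field_simp

theorem div_ne_zpow (hq0 : q ≠ 0) {w : ℂ} (hw : ∀ k : ℤ, w ≠ q ^ k) (k : ℤ) : w / q ≠ q ^ k := by
  intro h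
  apply hw (k + 1)
  rw [zpow_add_one₀ hq0, ← h, div_mul_cancel₀ _ hq0]

theorem summable_appellLerchTerm (hq0 : q ≠ 0) (hq1 : ‖q‖ < 1) {x z : ℂ} (hx0 : x ≠ 0)
    (hz0 : z ≠ 0) (h : ∀ k : ℤ, x * z ≠ q ^ k) : Summable (appellLerchTerm x q z) := by
  rw [funext (appellLerchTerm_eq hq0 x z)]
  exact summable_thetaTerm_div hq0 hq1 hz0 (div_ne_zero (mul_ne_zero hx0 hz0) hq0)
    (div_ne_zpow hq0 h)

theorem summable_dualTerm (a : ℂ) (hq1 : ‖q‖ < 1) : Summable (dualTerm a q) := by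
  obtain ⟨C, hC0, hC⟩ := exists_norm_le_of_tendsto (tendsto_qPoch (-q / a) hq1)
  obtain ⟨D, hD0, hD⟩ := exists_norm_le_of_tendsto (tendsto_qPoch (-a * q) hq1)
  refine ((summable_geometric_of_lt_one (norm_nonneg q) hq1).mul_right (C * D)).of_norm_bounded
    fun n => ?_
  rw [dualTerm, norm_mul, norm_mul]
  have := norm_pow_le_pow_of_le hq1 (Nat.le_succ n)
  gcongr
  exacts [hC _, hD _]

theorem eulerJ_one (q : ℂ) : eulerJ 1 q = qPochInf q q := by simp [eulerJ]

theorem dual_eq_appellLerch (hq0 : q ≠ 0) (hq1 : ‖q‖ < 1) {a : ℂ} (ha0 : a ≠ 0)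
    (ha : ∀ k : ℤ, -a ≠ q ^ k) :
    (1 + 1 / a) * ∑' n : ℕ, dualTerm a q n =
        -1 + a * mockG (-a) q
          + jTheta (-a) q / eulerJ 1 q * appellLerch (a ^ 2) q (-a⁻¹) := by
  have hx0 := neg_ne_zero.2 ha0
  have hE := qPochInf_self_ne_zero hq1
  have hj := jTheta_ne_zero hq1 hx0 ha
  have h1 := hasSum_dual hq0 hq1 hx0 ha
  have h2 := hasSum_mockGTerm hq0 hq1 hx0 ha
  have h3 : HasSum (fun m : ℕ => q ^ (m + 1) * (qPoch (q / -a) q m * qPoch (-a) q (m + 1)))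
      ((1 + a) * ∑' n : ℕ, dualTerm a q n) := by
    refine hasSum_of_eq ((summable_dualTerm a hq1).hasSum.mul_left (1 + a)) (fun m => ?_) rfl
    rw [qPoch_succ_left, dualTerm, div_neg, ← neg_div, mul_comm q (-a)]
    ring
  have h4 : ∑' r : ℤ, appellLerchTerm (a ^ 2) q (-a⁻¹) r =
      a⁻¹ * ∑' r : ℤ, thetaTerm q (q / -a) r / (1 - q ^ r * -a) := by
    -- The shift `r → r + 1` turns `q ^ (r - 1)` in the Appell-Lerch denominators into the `q ^ r`
    -- of `hasSum_dual`.
    rw [← tsum_mul_left, ← (Equiv.addRight (1 : ℤ)).tsum_eq]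
    refine tsum_congr fun r => ?_
    have hz : -a⁻¹ ≠ 0 := neg_ne_zero.2 (inv_ne_zero ha0)
    rw [appellLerchTerm_eq hq0, Equiv.coe_addRight, thetaTerm_add_one hq0 hz,
      show q / -a = -a⁻¹ * q by rw [div_neg, div_eq_mul_inv]; ring, thetaTerm_mul,
      zpow_add_one₀ hq0, show q ^ r * q * (a ^ 2 * -a⁻¹ / q) = q ^ r * -a by field_simp]
    ring
  have h5 : jTheta (-a⁻¹) q = a⁻¹ * jTheta (-a) q := by
    have := jTheta_inv hq0 hq1 hx0
    rw [inv_neg] at this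
    rw [this]; ring
  have h6 := h3.unique h1
  rw [mockG, h2.tsum_eq, appellLerch, h4, h5, eulerJ_one]
  set S := ∑' n : ℕ, dualTerm a q n
  have h7 : (1 + 1 / a) * S = a⁻¹ * ((1 + a) * S) := by field_simp; ring
  rw [h7, h6]
  field_simp
  ring

/-! ### Appell series, the Kronecker series and the change of `z` in an annulus. -/

/-- The sign of the cone expansions of bilateral geometric double series. -/
noncomputable def quadSign (r k : ℤ) : ℂ :=
  if 0 ≤ r ∧ 0 ≤ k then 1 else if r < 0 ∧ k < 0 then -1 else 0

theorem quadSign_sub (r k : ℤ) : quadSign r k - quadSign (r - 1) k = if r = 0 then 1 else 0 := by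
  unfold quadSign
  split_ifs <;> first | omega | norm_num

theorem quadSign_neg_one_sub (k : ℤ) : quadSign (-1 - k) k = 0 := by
  unfold quadSign
  split_ifs <;> first | omega | rfl

theorem summable_pow_natAbs {ρ : ℝ} (h0 : 0 ≤ ρ) (h1 : ρ < 1) :
    Summable (fun k : ℤ => ρ ^ k.natAbs) := by
  refine Summable.of_nat_of_neg ?_ ?_ <;> simpa using summable_geometric_of_lt_one h0 h1

/-- For `r ≥ 0` this is the geometric series in `w`; for `r < 0` it is minus the series in the
negative powers of `w`. -/
theorem hasSum_quadSign {w : ℂ} (r : ℤ) (h1 : 0 ≤ r → ‖w‖ < 1) (h2 : r < 0 → 1 < ‖w‖) :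
    HasSum (fun k : ℤ => quadSign r k * w ^ k) (1 / (1 - w)) := by
  rcases lt_or_ge r 0 with hr | hr
  · have hw := h2 hr
    have hw0 : w ≠ 0 := by rintro rfl; simp at hw; linarith
    have hw1 : 1 - w ≠ 0 := by
      intro h
      rw [← sub_eq_zero.1 h, norm_one] at hw
      exact lt_irrefl _ hw
    have hi : ‖w⁻¹‖ < 1 := by rw [norm_inv]; exact inv_lt_one_of_one_lt₀ hw
    have h := HasSum.of_nat_of_neg_add_one (f := fun k : ℤ => quadSign r k * w ^ k) (m := 0)
      (m' := -w⁻¹ * (1 - w⁻¹)⁻¹) ?_ ?_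
    · refine hasSum_of_eq h (fun _ => rfl) ?_
      have : 1 - w⁻¹ = -(1 - w) * w⁻¹ := by field_simp; ring
      rw [this]
      field_simp
      ring
    · refine hasSum_of_eq hasSum_zero (fun n => ?_) rfl
      rw [quadSign, if_neg (by omega), if_neg (by omega), zero_mul]
    · refine hasSum_of_eq ((hasSum_geometric_of_norm_lt_one hi).mul_left (-w⁻¹)) (fun n => ?_) rfl
      rw [quadSign, if_neg (by omega), if_pos (by omega), zpow_neg, ← Nat.cast_succ, zpow_natCast,
        Nat.succ_eq_add_one, pow_succ, mul_inv, inv_pow]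
      ring
  · have h := HasSum.of_nat_of_neg_add_one (f := fun k : ℤ => quadSign r k * w ^ k)
      (m := (1 - w)⁻¹) (m' := 0) ?_ ?_
    · refine hasSum_of_eq h (fun _ => rfl) ?_
      rw [add_zero, one_div]
    · refine hasSum_of_eq (hasSum_geometric_of_norm_lt_one (h1 hr)) (fun n => ?_) rfl
      rw [quadSign, if_pos (by omega), one_mul, zpow_natCast]
    · refine hasSum_of_eq hasSum_zero (fun n => ?_) rfl
      rw [quadSign, if_neg (by omega), if_neg (by omega), zero_mul]

theorem norm_zpow_le_natAbs {w : ℂ} {ρ : ℝ} (hw : w ≠ 0) {k : ℤ} (h1 : 0 ≤ k → ‖w‖ ≤ ρ)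
    (h2 : k < 0 → ‖w‖⁻¹ ≤ ρ) : ‖w ^ k‖ ≤ ρ ^ k.natAbs := by
  rw [norm_zpow]
  rcases lt_or_ge k 0 with hk | hk
  · obtain ⟨n, rfl⟩ : ∃ n : ℕ, k = -n := ⟨k.natAbs, by omega⟩
    rw [zpow_neg, zpow_natCast, Int.natAbs_neg, Int.natAbs_natCast, ← inv_pow]
    exact pow_le_pow_left₀ (by positivity) (h2 hk) n
  · obtain ⟨n, rfl⟩ := Int.eq_ofNat_of_zero_le hk
    rw [zpow_natCast, Int.natAbs_natCast]
    exact pow_le_pow_left₀ (by positivity) (h1 hk) n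

theorem norm_zpow_mul_lt_one (hq1 : ‖q‖ < 1) {u : ℂ} (hu1 : ‖u‖ < 1) {r : ℤ} (hr : 0 ≤ r) :
    ‖q ^ r * u‖ ≤ ‖u‖ ∧ ‖q ^ r * u‖ < 1 := by
  obtain ⟨n, rfl⟩ := Int.eq_ofNat_of_zero_le hr
  rw [norm_mul, zpow_natCast, norm_pow]
  have := mul_le_of_le_one_left (norm_nonneg u) (pow_le_one₀ (n := n) (norm_nonneg q) hq1.le)
  exact ⟨this, this.trans_lt hu1⟩

theorem inv_norm_zpow_mul_le (hq0 : q ≠ 0) (hq1 : ‖q‖ < 1) {u : ℂ} (hu : ‖q‖ < ‖u‖) {r : ℤ}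
    (hr : r < 0) : ‖q ^ r * u‖⁻¹ ≤ ‖q‖ / ‖u‖ ∧ 1 < ‖q ^ r * u‖ := by
  obtain ⟨n, rfl⟩ : ∃ n : ℕ, r = -(n + 1 : ℕ) := ⟨r.natAbs - 1, by omega⟩
  have hq : 0 < ‖q‖ := norm_pos_iff.2 hq0
  have hu0 : 0 < ‖u‖ := hq.trans hu
  have h1 : ‖q ^ (-(n + 1 : ℕ) : ℤ) * u‖⁻¹ = ‖q‖ ^ n * (‖q‖ / ‖u‖) := by
    rw [norm_mul, zpow_neg, zpow_natCast, norm_inv, norm_pow, pow_succ]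
    field_simp
  have h2 : ‖q ^ (-(n + 1 : ℕ) : ℤ) * u‖⁻¹ ≤ ‖q‖ / ‖u‖ := by
    rw [h1]
    exact mul_le_of_le_one_left (by positivity) (pow_le_one₀ (norm_nonneg q) hq1.le)
  refine ⟨h2, ?_⟩
  have h3 := h2.trans_lt ((div_lt_one hu0).2 hu)
  have h4 : 0 < ‖q ^ (-(n + 1 : ℕ) : ℤ) * u‖⁻¹ := by rw [h1]; positivity
  exact (inv_lt_one₀ (inv_pos.1 h4)).1 h3

/-- The Appell series `∑ (-1)^r q^{r(r-1)/2} z^r / (1 - q^r u)`. -/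
noncomputable def appellSeries (q z u : ℂ) : ℂ := ∑' r : ℤ, thetaTerm q z r / (1 - q ^ r * u)

/-- The partial sums (in both directions) of `∑ x^k / ((-1)^k q^{k(k-1)/2})`. -/
noncomputable def partialThetaSum (q x : ℂ) (n : ℤ) : ℂ :=
  ∑' k : ℤ, quadSign (n - k) k * (x ^ k / thetaTerm q 1 k)

theorem summable_partialThetaSum (q x : ℂ) (n : ℤ) :
    Summable (fun k : ℤ => quadSign (n - k) k * (x ^ k / thetaTerm q 1 k)) := by
  refine summable_of_ne_finset_zero (s := Finset.Icc (-(|n|)) |n|) fun k hk => ?_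
  rw [quadSign, if_neg, if_neg, zero_mul]
  · rintro ⟨h1, h2⟩
    exact hk (Finset.mem_Icc.2 ⟨by have := neg_abs_le n; omega, by have := abs_nonneg n; omega⟩)
  · rintro ⟨h1, h2⟩
    exact hk (Finset.mem_Icc.2 ⟨by have := abs_nonneg n; omega, by have := le_abs_self n; omega⟩)

theorem partialThetaSum_sub (q x : ℂ) (n : ℤ) :
    partialThetaSum q x n - partialThetaSum q x (n - 1) = x ^ n / thetaTerm q 1 n := by
  have h := (summable_partialThetaSum q x n).hasSum.sub (summable_partialThetaSum q x (n - 1)).hasSum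
  refine h.unique (hasSum_of_eq (hasSum_ite_eq n (x ^ n / thetaTerm q 1 n)) (fun k => ?_) rfl)
  rw [← sub_mul, show n - 1 - k = n - k - 1 by ring, quadSign_sub]
  by_cases hk : k = n
  · subst hk; simp
  · rw [if_neg (by omega), if_neg hk, zero_mul]

theorem partialThetaSum_neg_one (q x : ℂ) : partialThetaSum q x (-1) = 0 := by
  simp [partialThetaSum, quadSign_neg_one_sub]

/-- In the annulus, `‖q ^ r * (x * z)‖ < 1` exactly when `r ≥ 0`, so every denominator expands by
`hasSum_quadSign`. Collecting by `n = r + k` removes `z` from the inner sum, which is then the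
partial theta sum. -/
theorem hasSum_appellSeries (hq0 : q ≠ 0) (hq1 : ‖q‖ < 1) {z x : ℂ} (hz : z ≠ 0) (hx : x ≠ 0)
    (h1 : ‖q‖ < ‖x * z‖) (h2 : ‖x * z‖ < 1) :
    HasSum (fun n : ℤ => thetaTerm q z n * partialThetaSum q x n) (appellSeries q z (x * z)) := by
  set u := x * z with hu
  have hu0 : u ≠ 0 := mul_ne_zero hx hz
  have hun : 0 < ‖u‖ := norm_pos_iff.2 hu0
  set ρ := max ‖u‖ (‖q‖ / ‖u‖) with hρ
  have hρ1 : ρ < 1 := max_lt h2 ((div_lt_one hun).2 h1)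
  have hρ0 : 0 ≤ ρ := (norm_nonneg u).trans (le_max_left _ _)
  set F : ℤ × ℤ → ℂ := fun p => thetaTerm q z p.1 * (quadSign p.1 p.2 * (q ^ p.1 * u) ^ p.2) with hF
  have hs : Summable F := by
    have h := (summable_norm_thetaTerm hq0 hq1 hz).mul_of_nonneg (summable_pow_natAbs hρ0 hρ1)
      (fun _ => norm_nonneg _) (fun _ => by positivity)
    refine h.of_norm_bounded fun p => ?_
    rw [hF, norm_mul]
    refine mul_le_mul_of_nonneg_left ?_ (norm_nonneg _)
    have hw : q ^ p.1 * u ≠ 0 := mul_ne_zero (zpow_ne_zero _ hq0) hu0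
    unfold quadSign
    split_ifs with ha hb
    · rw [one_mul]
      exact norm_zpow_le_natAbs hw (fun _ =>
        (norm_zpow_mul_lt_one hq1 h2 ha.1).1.trans (le_max_left _ _)) (fun h => by omega)
    · rw [neg_one_mul, norm_neg]
      exact norm_zpow_le_natAbs hw (fun h => by omega) (fun _ =>
        (inv_norm_zpow_mul_le hq0 hq1 h1 hb.1).1.trans (le_max_right _ _))
    · rw [zero_mul, norm_zero]; positivity
  have e1 := (hs.hasSum.prod_fiberwise fun r => (hasSum_quadSign (w := q ^ r * u) r
    (fun h => (norm_zpow_mul_lt_one hq1 h2 h).2)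
    (fun h => (inv_norm_zpow_mul_le hq0 hq1 h1 h).2)).mul_left (thetaTerm q z r)).tsum_eq
  simp_rw [mul_one_div] at e1
  let e : ℤ × ℤ ≃ ℤ × ℤ :=
    { toFun := fun p => (p.1 - p.2, p.2)
      invFun := fun p => (p.1 + p.2, p.2)
      left_inv := fun p => by simp
      right_inv := fun p => by simp }
  have e2 : HasSum (F ∘ e) (appellSeries q z u) := by
    rw [appellSeries, e1]
    exact e.hasSum_iff.2 hs.hasSum
  refine e2.prod_fiberwise fun n => hasSum_of_eq ((summable_partialThetaSum q x n).hasSum.mul_left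
    (thetaTerm q z n)) (fun k => ?_) rfl
  have h3 := thetaTerm_add hq0 hz (n - k) k
  rw [sub_add_cancel] at h3
  have h4 : thetaTerm q z k = thetaTerm q 1 k * z ^ k := by rw [← thetaTerm_mul, one_mul]
  have h5 := thetaTerm_ne_zero hq0 one_ne_zero k
  simp only [hF, Function.comp, e, Equiv.coe_fn_mk]
  rw [h3, h4, hu, mul_zpow, mul_zpow, ← zpow_mul]
  field_simp

theorem inv_ne_zpow {w : ℂ} (hw : ∀ k : ℤ, w ≠ q ^ k) (k : ℤ) : w⁻¹ ≠ q ^ k := by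
  intro h
  apply hw (-k)
  rw [zpow_neg, ← h, inv_inv]

/-- The Kronecker series `∑ u^r / (1 - q^r y)`. -/
noncomputable def kroneckerSeries (q u y : ℂ) : ℂ := ∑' r : ℤ, u ^ r / (1 - q ^ r * y)

theorem summable_norm_kronecker (hq0 : q ≠ 0) (hq1 : ‖q‖ < 1) {u y : ℂ} (h1 : ‖q‖ < ‖u‖)
    (h2 : ‖u‖ < 1) (hy0 : y ≠ 0) (hy : ∀ k : ℤ, y ≠ q ^ k) :
    Summable (fun r : ℤ => ‖u ^ r / (1 - q ^ r * y)‖) := by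
  obtain ⟨δ, hδ, h⟩ := exists_le_norm_one_sub hq0 hq1 hy0 hy
  have hun : 0 < ‖u‖ := (norm_nonneg q).trans_lt h1
  have hu0 : u ≠ 0 := norm_pos_iff.1 hun
  have hyn : 0 < ‖y‖ := norm_pos_iff.2 hy0
  set ρ := max ‖u‖ (‖q‖ / ‖u‖) with hρ
  have hρ1 : ρ < 1 := max_lt h2 ((div_lt_one hun).2 h1)
  have hρ0 : 0 ≤ ρ := (norm_nonneg u).trans (le_max_left _ _)
  refine ((summable_pow_natAbs hρ0 hρ1).mul_right (δ⁻¹ * max 1 ‖y‖⁻¹)).of_nonneg_of_le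
    (fun _ => norm_nonneg _) fun r => ?_
  have hpos : 0 < δ * (1 + ‖q ^ r * y‖) := by positivity
  rw [norm_div]
  refine (div_le_div_of_nonneg_left (norm_nonneg _) hpos (h r)).trans ?_
  -- For negative `r` the denominator grows like `q ^ r`, so the term behaves like `(u / q) ^ r`;
  -- this is where `‖q‖ < ‖u‖` enters.
  rcases lt_or_ge r 0 with hr | hr
  · have hqy : 0 < ‖q ^ r * y‖ := norm_pos_iff.2 (mul_ne_zero (zpow_ne_zero _ hq0) hy0)
    have e1 : ‖u ^ r‖ / (δ * (1 + ‖q ^ r * y‖)) ≤ ‖u ^ r‖ / (δ * ‖q ^ r * y‖) := by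
      gcongr; linarith
    refine e1.trans ?_
    have e2 : ‖u ^ r‖ / (δ * ‖q ^ r * y‖) = ‖(u / q) ^ r‖ * (δ⁻¹ * ‖y‖⁻¹) := by
      rw [div_zpow, norm_div, norm_mul]
      field_simp
    rw [e2]
    have e3 : ‖(u / q) ^ r‖ ≤ ρ ^ r.natAbs := norm_zpow_le_natAbs (div_ne_zero hu0 hq0)
      (fun h => by omega) fun _ => by
        rw [norm_div, inv_div]
        exact le_max_right _ _
    gcongr
    exact le_max_right _ _
  · have e1 : ‖u ^ r‖ / (δ * (1 + ‖q ^ r * y‖)) ≤ ‖u ^ r‖ / (δ * 1) := by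
      gcongr; linarith [norm_nonneg (q ^ r * y)]
    refine e1.trans ?_
    have e3 : ‖u ^ r‖ ≤ ρ ^ r.natAbs := norm_zpow_le_natAbs hu0
      (fun _ => le_max_left _ _) (fun h => by omega)
    rw [div_eq_mul_inv, mul_inv, inv_one]
    gcongr
    exact le_max_left _ _

/-- Passing from `n` to `n + 1` cancels the denominator in the difference and leaves a theta series
at `q ^ n * z`. By quasi-periodicity this is `jTheta z q` times one increment of the partial theta
sum. -/
theorem tsum_thetaTerm_mul_zpow (hq0 : q ≠ 0) (hq1 : ‖q‖ < 1) {x z : ℂ} (hx : x ≠ 0) (hz : z ≠ 0)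
    (hv : ∀ k : ℤ, x * z ≠ q ^ k) (n : ℤ) :
    HasSum (fun r : ℤ => thetaTerm q z r * (q ^ r * (x * z)) ^ n / (1 - q ^ r * (x * z)))
      (appellSeries q z (x * z) - jTheta z q * partialThetaSum q x (n - 1)) := by
  have hv0 := mul_ne_zero hx hz
  have hs (n : ℤ) : Summable
      (fun r : ℤ => thetaTerm q z r * (q ^ r * (x * z)) ^ n / (1 - q ^ r * (x * z))) := by
    refine ((summable_thetaTerm_div hq0 hq1 (mul_ne_zero hz (zpow_ne_zero n hq0)) hv0 hv).mul_left
      ((x * z) ^ n)).congr fun r => ?_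
    rw [thetaTerm_mul, mul_zpow (q ^ r), ← zpow_mul, ← zpow_mul, mul_comm n r]
    ring
  set g : ℤ → ℂ := fun n => (∑' r : ℤ, thetaTerm q z r * (q ^ r * (x * z)) ^ n /
    (1 - q ^ r * (x * z))) + jTheta z q * partialThetaSum q x (n - 1) with hg
  have hstep (n : ℤ) : g (n + 1) = g n := by
    have h1 := (hs n).hasSum.sub (hs (n + 1)).hasSum
    have h2 := h1.unique (hasSum_of_eq ((hasSum_thetaTerm hq0 hq1
      (mul_ne_zero (zpow_ne_zero n hq0) hz)).mul_left ((x * z) ^ n)) (fun r => ?_) rfl)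
    · have h3 := partialThetaSum_sub q x n
      rw [jTheta_zpow_mul hq0 hq1 hz] at h2
      have h4 : thetaTerm q z n = thetaTerm q 1 n * z ^ n := by rw [← thetaTerm_mul, one_mul]
      have h5 := thetaTerm_ne_zero hq0 one_ne_zero n
      have h6 := zpow_ne_zero n hz
      have h7 : (x * z) ^ n * (jTheta z q / thetaTerm q z n) =
          jTheta z q * (x ^ n / thetaTerm q 1 n) := by
        rw [h4, mul_zpow]
        field_simp
      rw [h7, ← h3] at h2
      simp only [hg]
      rw [add_sub_cancel_right]
      linear_combination -h2
    · have h3 := one_sub_zpow_mul_ne_zero hv r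
      have h4 : q ^ r * (x * z) ≠ 0 := mul_ne_zero (zpow_ne_zero _ hq0) hv0
      rw [mul_comm (q ^ n) z, thetaTerm_mul, zpow_add_one₀ h4, mul_zpow (q ^ r), ← zpow_mul,
        ← zpow_mul, mul_comm n r]
      field_simp
      have h8 : 1 - x * z * q ^ r ≠ 0 := by rwa [mul_comm] at h3
      exact mul_div_cancel_right₀ _ h8
  have hc (n : ℤ) : g n = g 0 := by
    induction n using Int.induction_on with
    | zero => rfl
    | succ k ih => rw [hstep, ih]
    | pred k ih => rw [← ih, ← hstep, sub_add_cancel]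
  refine hasSum_of_eq (hs n).hasSum (fun _ => rfl) ?_
  have h1 := hc n
  simp only [hg, zpow_zero, mul_one, zero_sub, partialThetaSum_neg_one, mul_zero, add_zero] at h1
  rw [appellSeries, ← h1]
  ring

/-- The product on the left is a double series. Reindexed by `e` and summed over `r` first, it is
evaluated by `tsum_thetaTerm_mul_zpow`; the remaining sum over `n` is a theta series and the
expansion `hasSum_appellSeries`. -/
theorem jTheta_mul_kroneckerSeries (hq0 : q ≠ 0) (hq1 : ‖q‖ < 1) {x z₀ z₁ : ℂ} (hx : x ≠ 0)
    (hz₀ : z₀ ≠ 0) (hz₁ : z₁ ≠ 0) (hv : ∀ k : ℤ, x * z₀ ≠ q ^ k) (h1 : ‖q‖ < ‖x * z₁‖)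
    (h2 : ‖x * z₁‖ < 1) :
    jTheta (x * z₁ * z₀) q * kroneckerSeries q (x * z₁) (x * z₀)⁻¹ =
      jTheta z₀ q * appellSeries q z₁ (x * z₁) - jTheta z₁ q * appellSeries q z₀ (x * z₀) := by
  have hu0 := mul_ne_zero hx hz₁
  have hv0 := mul_ne_zero hx hz₀
  have s1 := summable_norm_thetaTerm hq0 hq1 (mul_ne_zero hu0 hz₀)
  have s2 := summable_norm_kronecker hq0 hq1 h1 h2 (inv_ne_zero hv0) (inv_ne_zpow hv)
  have sK : HasSum (fun r : ℤ => (x * z₁) ^ r / (1 - q ^ r * (x * z₀)⁻¹))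
      (kroneckerSeries q (x * z₁) (x * z₀)⁻¹) := s2.of_norm.hasSum
  obtain ⟨F, hF⟩ : ∃ F : ℤ × ℤ → ℂ, F = fun p => thetaTerm q (x * z₁ * z₀) p.1 *
    ((x * z₁) ^ p.2 / (1 - q ^ p.2 * (x * z₀)⁻¹)) := ⟨_, rfl⟩
  have s3 : HasSum F (jTheta (x * z₁ * z₀) q * kroneckerSeries q (x * z₁) (x * z₀)⁻¹) := by
    rw [hF]
    exact HasSum.mul (f := thetaTerm q (x * z₁ * z₀))
      (g := fun r : ℤ => (x * z₁) ^ r / (1 - q ^ r * (x * z₀)⁻¹))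
      (hasSum_thetaTerm hq0 hq1 (mul_ne_zero hu0 hz₀)) sK
      (summable_mul_of_summable_norm (f := thetaTerm q (x * z₁ * z₀))
      (g := fun r : ℤ => (x * z₁) ^ r / (1 - q ^ r * (x * z₀)⁻¹)) s1 s2)
  let e : ℤ × ℤ ≃ ℤ × ℤ :=
    { toFun := fun p => (p.1 + p.2, -p.2)
      invFun := fun p => (p.1 + p.2, -p.2)
      left_inv := fun p => by simp
      right_inv := fun p => by simp }
  have s4 : HasSum (fun n : ℤ => -thetaTerm q z₁ n * (appellSeries q z₀ (x * z₀) -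
      jTheta z₀ q * partialThetaSum q x (n + 1 - 1)))
      (jTheta (x * z₁ * z₀) q * kroneckerSeries q (x * z₁) (x * z₀)⁻¹) := by
    have s5 : HasSum (F ∘ e) _ := e.hasSum_iff.2 s3
    refine s5.prod_fiberwise fun n => hasSum_of_eq
      ((tsum_thetaTerm_mul_zpow hq0 hq1 hx hz₀ hv (n + 1)).mul_left (-thetaTerm q z₁ n))
      (fun r => ?_) rfl
    simp only [hF, Function.comp, e, Equiv.coe_fn_mk]
    have hy := one_sub_zpow_mul_ne_zero hv r
    have hy0 : q ^ r * (x * z₀) ≠ 0 := mul_ne_zero (zpow_ne_zero _ hq0) hv0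
    have e1 : 1 / (1 - q ^ (-r) * (x * z₀)⁻¹) =
        -(q ^ r * (x * z₀)) / (1 - q ^ r * (x * z₀)) := by
      rw [zpow_neg, ← mul_inv]
      generalize q ^ r * (x * z₀) = y at hy hy0
      have : 1 - y⁻¹ = -(1 - y) / y := by field_simp; ring
      rw [this, one_div_div, div_neg, neg_div]
    have e2 : thetaTerm q z₁ n = thetaTerm q 1 n * z₁ ^ n := by rw [← thetaTerm_mul, one_mul]
    have e3 : thetaTerm q z₀ n = thetaTerm q 1 n * z₀ ^ n := by rw [← thetaTerm_mul, one_mul]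
    rw [div_eq_mul_one_div, e1, mul_comm (x * z₁) z₀, thetaTerm_mul, thetaTerm_add hq0 hz₀,
      zpow_add_one₀ hy0, e2, e3, zpow_add₀ hu0, zpow_neg]
    have e4 : (q ^ r * (x * z₀)) ^ n = q ^ (n * r) * (x ^ n * z₀ ^ n) := by
      rw [mul_zpow, ← zpow_mul, mul_zpow, mul_comm r]
    have e5 := zpow_ne_zero r hu0
    rw [e4, mul_zpow x z₁ n]
    have e6 := mul_inv_cancel₀ e5
    generalize (x * z₁) ^ r = U at e6
    linear_combination (-1) * (thetaTerm q 1 n * z₀ ^ n * thetaTerm q z₀ r * q ^ (n * r) *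
      x ^ n * z₁ ^ n * (q ^ r * (x * z₀)) / (1 - q ^ r * (x * z₀))) * e6
  refine s4.unique (hasSum_of_eq (((hasSum_appellSeries hq0 hq1 hz₁ hx h1 h2).mul_left
    (jTheta z₀ q)).sub ((hasSum_thetaTerm hq0 hq1 hz₁).mul_right (appellSeries q z₀ (x * z₀))))
    (fun n => ?_) rfl)
  rw [add_sub_cancel_right]
  ring

/-- Replace `r` by `-r` and write `1 / (1 - y⁻¹) = 1 - 1 / (1 - y)` with `y = q ^ r * x⁻¹`. The
constant part sums to `jTheta q q = 0`, the rest is `hasSum_reciprocal`. -/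
theorem appellSeries_one (hq0 : q ≠ 0) (hq1 : ‖q‖ < 1) {x : ℂ} (hx0 : x ≠ 0)
    (hx : ∀ k : ℤ, x ≠ q ^ k) :
    appellSeries q 1 x = -(qPochInf q q ^ 3 / jTheta x⁻¹ q) := by
  have h1 := (hasSum_thetaTerm hq0 hq1 hq0).sub
    (hasSum_reciprocal hq0 hq1 (inv_ne_zero hx0) (inv_ne_zpow hx))
  have h2 := (Equiv.neg ℤ).hasSum_iff.2
    (summable_thetaTerm_div hq0 hq1 one_ne_zero hx0 hx).hasSum
  rw [appellSeries, h2.unique (hasSum_of_eq h1 (fun r => ?_) rfl)]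
  · have h3 := jTheta_div hq0 (1 : ℂ)
    rw [div_one, jTheta_one hq1] at h3
    rw [h3, zero_sub]
  · simp only [Function.comp, Equiv.neg_apply]
    rw [thetaTerm_neg hq0 one_ne_zero, div_one, zpow_neg]
    have h3 := one_sub_zpow_mul_ne_zero (inv_ne_zpow hx) r
    have h4 : 1 - (q ^ r)⁻¹ * x ≠ 0 := by
      have := one_sub_zpow_mul_ne_zero hx (-r)
      rwa [zpow_neg] at this
    have h5 := zpow_ne_zero r hq0
    field_simp
    have h6 : x - q ^ r ≠ 0 := by
      intro h
      exact hx r (sub_eq_zero.1 h)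
    have h7 : q ^ r - x ≠ 0 := by
      intro h
      exact hx r (sub_eq_zero.1 h).symm
    field_simp
    ring

theorem jTheta_mul_appellSeries_sub_of_annulus (hq0 : q ≠ 0) (hq1 : ‖q‖ < 1) {x z₀ z₁ : ℂ}
    (hx : x ≠ 0) (hz₀ : z₀ ≠ 0) (hz₁ : z₁ ≠ 0) (hv : ∀ k : ℤ, x * z₀ ≠ q ^ k)
    (h1 : ‖q‖ < ‖x * z₁‖) (h2 : ‖x * z₁‖ < 1) :
    (jTheta z₀ q * appellSeries q z₁ (x * z₁) - jTheta z₁ q * appellSeries q z₀ (x * z₀)) *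
      (jTheta (x * z₁) q * jTheta (x * z₀)⁻¹ q) =
      qPochInf q q ^ 3 * jTheta (x * z₁ * z₀) q * jTheta (z₁ / z₀) q := by
  have hv0 := mul_ne_zero hx hz₀
  have hjv := jTheta_ne_zero hq1 (inv_ne_zero hv0) (inv_ne_zpow hv)
  rw [← jTheta_mul_kroneckerSeries hq0 hq1 hx hz₀ hz₁ hv h1 h2]
  have e : x * z₀ * (z₁ / z₀) = x * z₁ := by field_simp
  -- The same Kronecker series arises from the parameters `x * z₀`, `1`, `z₁ / z₀`. There `jTheta 1
  -- q = 0` kills one term, which evaluates the series in closed form.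
  have h3 := jTheta_mul_kroneckerSeries hq0 hq1 hv0 one_ne_zero (div_ne_zero hz₁ hz₀)
    (by rwa [mul_one]) (by rwa [e]) (by rwa [e])
  rw [e, mul_one, mul_one, jTheta_one hq1, zero_mul, zero_sub,
    appellSeries_one hq0 hq1 hv0 hv] at h3
  generalize kroneckerSeries q (x * z₁) (x * z₀)⁻¹ = K at h3 ⊢
  generalize jTheta (x * z₀)⁻¹ q = J at h3 hjv ⊢
  field_simp at h3
  linear_combination jTheta (x * z₁ * z₀) q * h3

/-! ### Extension of the change of `z` beyond the annulus. -/

theorem appellSeries_mul_self (hq0 : q ≠ 0) {z : ℂ} (hz : z ≠ 0) (u : ℂ) :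
    appellSeries q (q * z) (q * u) = -z⁻¹ * appellSeries q z u := by
  unfold appellSeries
  rw [← tsum_mul_left, ← (Equiv.addRight (1 : ℤ)).tsum_eq (fun r => -z⁻¹ * _)]
  refine tsum_congr fun r => ?_
  rw [Equiv.coe_addRight, thetaTerm_add_one hq0 hz, mul_comm q z, thetaTerm_mul,
    zpow_add_one₀ hq0, mul_assoc (q ^ r) q u]
  field_simp

/-- The difference of the two sides of the formula for changing the parameter `z` in the
Appell series. -/
noncomputable def appellDefect (q z₀ z₁ x : ℂ) : ℂ :=
  (jTheta z₀ q * appellSeries q z₁ (x * z₁) - jTheta z₁ q * appellSeries q z₀ (x * z₀)) *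
      (jTheta (x * z₁) q * jTheta (x * z₀)⁻¹ q) -
    qPochInf q q ^ 3 * jTheta (x * z₁ * z₀) q * jTheta (z₁ / z₀) q

theorem appellDefect_mul_self (hq0 : q ≠ 0) (hq1 : ‖q‖ < 1) {x z₀ z₁ : ℂ} (hx : x ≠ 0)
    (hz₀ : z₀ ≠ 0) (hz₁ : z₁ ≠ 0) :
    appellDefect q z₀ (q * z₁) x = z₁⁻¹ * (x * z₁)⁻¹ * appellDefect q z₀ z₁ x := by
  unfold appellDefect
  have hu := mul_ne_zero hx hz₁
  rw [mul_left_comm x q, appellSeries_mul_self hq0 hz₁, jTheta_mul_self hq0 hq1 hz₁,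
    jTheta_mul_self hq0 hq1 hu, mul_assoc q (x * z₁), mul_div_assoc,
    jTheta_mul_self hq0 hq1 (mul_ne_zero hu hz₀), jTheta_mul_self hq0 hq1 (div_ne_zero hz₁ hz₀)]
  generalize (x * z₀)⁻¹ = w
  field_simp
  ring

theorem appellDefect_eq_zero_of_zpow_mul (hq0 : q ≠ 0) (hq1 : ‖q‖ < 1) {x z₀ z₁ : ℂ} (hx : x ≠ 0)
    (hz₀ : z₀ ≠ 0) (hz₁ : z₁ ≠ 0) (k : ℤ) (h : appellDefect q z₀ (q ^ k * z₁) x = 0) :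
    appellDefect q z₀ z₁ x = 0 := by
  have hstep (k : ℤ) : appellDefect q z₀ (q ^ (k + 1) * z₁) x = 0 ↔
      appellDefect q z₀ (q ^ k * z₁) x = 0 := by
    have hw : q ^ k * z₁ ≠ 0 := mul_ne_zero (zpow_ne_zero _ hq0) hz₁
    rw [zpow_add_one₀ hq0, mul_comm (q ^ k) q, mul_assoc, appellDefect_mul_self hq0 hq1 hx hz₀ hw,
      mul_eq_zero_iff_left]
    exact mul_ne_zero (inv_ne_zero hw) (inv_ne_zero (mul_ne_zero hx hw))
  have hc (k : ℤ) : appellDefect q z₀ (q ^ k * z₁) x = 0 ↔ appellDefect q z₀ z₁ x = 0 := by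
    induction k using Int.induction_on with
    | zero => simp
    | succ k ih => rw [hstep, ih]
    | pred k ih => rw [← ih, ← hstep, sub_add_cancel]
  exact (hc k).1 h

theorem exists_zpow_mul_mem_annulus (hq0 : q ≠ 0) (hq1 : ‖q‖ < 1) {u : ℂ} (hu : u ≠ 0)
    (h : ∀ k : ℤ, ‖u‖ ≠ ‖q‖ ^ k) : ∃ k : ℤ, ‖q‖ < ‖q ^ k * u‖ ∧ ‖q ^ k * u‖ < 1 := by
  have hq : 0 < ‖q‖ := norm_pos_iff.2 hq0
  obtain ⟨n, h1, h2⟩ := exists_mem_Ico_zpow (norm_pos_iff.2 hu) ((one_lt_inv₀ hq).2 hq1)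
  rw [inv_zpow, ← zpow_neg] at h1 h2
  have h3 := lt_of_le_of_ne h1 (h _).symm
  refine ⟨n + 1, ?_, ?_⟩ <;> rw [norm_mul, norm_zpow]
  · calc ‖q‖ = ‖q‖ ^ (n + 1) * ‖q‖ ^ (-n) := by rw [← zpow_add₀ hq.ne']; simp
      _ < _ := by gcongr
  · calc _ < ‖q‖ ^ (n + 1) * ‖q‖ ^ (-(n + 1)) := by gcongr
      _ = 1 := by rw [← zpow_add₀ hq.ne']; simp

theorem appellDefect_eq_zero_of_norm_ne (hq0 : q ≠ 0) (hq1 : ‖q‖ < 1) {x z₀ z₁ : ℂ} (hx : x ≠ 0)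
    (hz₀ : z₀ ≠ 0) (hz₁ : z₁ ≠ 0) (hv : ∀ k : ℤ, x * z₀ ≠ q ^ k)
    (hu : ∀ k : ℤ, ‖x * z₁‖ ≠ ‖q‖ ^ k) : appellDefect q z₀ z₁ x = 0 := by
  obtain ⟨k, h1, h2⟩ := exists_zpow_mul_mem_annulus hq0 hq1 (mul_ne_zero hx hz₁) hu
  refine appellDefect_eq_zero_of_zpow_mul hq0 hq1 hx hz₀ hz₁ k (sub_eq_zero.2 ?_)
  rw [mul_left_comm] at h1 h2
  exact jTheta_mul_appellSeries_sub_of_annulus hq0 hq1 hx hz₀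
    (mul_ne_zero (zpow_ne_zero _ hq0) hz₁) hv h1 h2

theorem eventually_le_norm_one_sub (hq0 : q ≠ 0) (hq1 : ‖q‖ < 1) {w : ℂ} (hw0 : w ≠ 0)
    (hw : ∀ k : ℤ, w ≠ q ^ k) :
    ∃ δ : ℝ, 0 < δ ∧ ∀ᶠ w' in 𝓝 w, ∀ r : ℤ, δ ≤ ‖1 - q ^ r * w'‖ := by
  obtain ⟨δ, hδ, h⟩ := exists_le_norm_one_sub hq0 hq1 hw0 hw
  refine ⟨δ / 2, half_pos hδ, ?_⟩
  have hε : 0 < δ / 2 * ‖w‖ := by positivity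
  filter_upwards [Metric.ball_mem_nhds w hε] with w' hw' r
  rw [Metric.mem_ball, dist_eq_norm] at hw'
  have h1 := norm_sub_norm_le (1 - q ^ r * w) (q ^ r * (w' - w))
  rw [show 1 - q ^ r * w - q ^ r * (w' - w) = 1 - q ^ r * w' by ring, norm_mul] at h1
  have h2 : ‖q ^ r‖ * ‖w' - w‖ ≤ ‖q ^ r‖ * (δ / 2 * ‖w‖) := by gcongr
  have h3 := h r
  rw [norm_mul] at h3
  nlinarith [mul_nonneg (norm_nonneg (q ^ r)) (norm_nonneg w)]

theorem eventually_ne_zpow (hq0 : q ≠ 0) (hq1 : ‖q‖ < 1) {w : ℂ} (hw0 : w ≠ 0)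
    (hw : ∀ k : ℤ, w ≠ q ^ k) : ∀ᶠ w' in 𝓝 w, ∀ k : ℤ, w' ≠ q ^ k := by
  obtain ⟨δ, hδ, h⟩ := eventually_le_norm_one_sub hq0 hq1 hw0 hw
  filter_upwards [h] with w' hw' k hk
  have := hw' (-k)
  rw [hk, ← zpow_add₀ hq0, neg_add_cancel, zpow_zero, sub_self, norm_zero] at this
  linarith

theorem continuousAt_appellSeries (hq0 : q ≠ 0) (hq1 : ‖q‖ < 1) {z w : ℂ} (hz : z ≠ 0)
    (hw0 : w ≠ 0) (hw : ∀ k : ℤ, w ≠ q ^ k) : ContinuousAt (appellSeries q z) w := by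
  obtain ⟨δ, hδ, h⟩ := eventually_le_norm_one_sub hq0 hq1 hw0 hw
  refine tendsto_tsum_of_dominated_convergence
    ((summable_norm_thetaTerm hq0 hq1 hz).mul_right δ⁻¹) (fun r => ?_) ?_
  · have : Tendsto (fun w' : ℂ => 1 - q ^ r * w') (𝓝 w) (𝓝 (1 - q ^ r * w)) :=
      (Continuous.tendsto (by fun_prop) w)
    exact tendsto_const_nhds.div this (one_sub_zpow_mul_ne_zero hw r)
  · filter_upwards [h] with w' hw' r
    rw [norm_div, div_eq_mul_inv]
    have := hw' r
    gcongr

theorem appellSeries_self (hq0 : q ≠ 0) (hq1 : ‖q‖ < 1) {w : ℂ} (hw0 : w ≠ 0)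
    (hw : ∀ k : ℤ, w ≠ q ^ k) : appellSeries q q w = qPochInf q q ^ 3 / jTheta w q :=
  (hasSum_reciprocal hq0 hq1 hw0 hw).tsum_eq

/-- Away from its zeros the theta function is a constant divided by an Appell series, so continuity
is inherited from `continuousAt_appellSeries`. -/
theorem continuousAt_jTheta (hq0 : q ≠ 0) (hq1 : ‖q‖ < 1) {w : ℂ} (hw0 : w ≠ 0)
    (hw : ∀ k : ℤ, w ≠ q ^ k) : ContinuousAt (fun w => jTheta w q) w := by
  have hE := pow_ne_zero 3 (qPochInf_self_ne_zero hq1)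
  have h1 : appellSeries q q w ≠ 0 := by
    rw [appellSeries_self hq0 hq1 hw0 hw]
    exact div_ne_zero hE (jTheta_ne_zero hq1 hw0 hw)
  have h2 : ContinuousAt (fun w => qPochInf q q ^ 3 / appellSeries q q w) w :=
    continuousAt_const.div (continuousAt_appellSeries hq0 hq1 hq0 hw0 hw) h1
  refine h2.congr ?_
  filter_upwards [eventually_ne_zpow hq0 hq1 hw0 hw, eventually_ne_nhds hw0] with w' hw' hw0'
  rw [appellSeries_self hq0 hq1 hw0' hw', div_div_cancel₀ hE]

theorem continuousAt_appellDefect (hq0 : q ≠ 0) (hq1 : ‖q‖ < 1) {x z₀ z₁ : ℂ} (hx : x ≠ 0)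
    (hz₀ : z₀ ≠ 0) (hz₁ : z₁ ≠ 0) (hv : ∀ k : ℤ, x * z₀ ≠ q ^ k) (hu : ∀ k : ℤ, x * z₁ ≠ q ^ k)
    (hw : ∀ k : ℤ, x * z₁ * z₀ ≠ q ^ k) : ContinuousAt (appellDefect q z₀ z₁) x := by
  have hv0 := mul_ne_zero hx hz₀
  have hu0 := mul_ne_zero hx hz₁
  have c (z : ℂ) : ContinuousAt (fun y => y * z) x := by fun_prop
  have a1 : ContinuousAt (fun y => appellSeries q z₁ (y * z₁)) x :=
    ContinuousAt.comp (f := fun y => y * z₁) (continuousAt_appellSeries hq0 hq1 hz₁ hu0 hu) (c z₁)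
  have a2 : ContinuousAt (fun y => appellSeries q z₀ (y * z₀)) x :=
    ContinuousAt.comp (f := fun y => y * z₀) (continuousAt_appellSeries hq0 hq1 hz₀ hv0 hv) (c z₀)
  have a3 : ContinuousAt (fun y => jTheta (y * z₁) q) x :=
    ContinuousAt.comp (f := fun y => y * z₁) (continuousAt_jTheta hq0 hq1 hu0 hu) (c z₁)
  have a4 : ContinuousAt (fun y => jTheta (y * z₀)⁻¹ q) x :=
    ContinuousAt.comp (f := fun y => (y * z₀)⁻¹) (continuousAt_jTheta hq0 hq1 (inv_ne_zero hv0)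
      (inv_ne_zpow hv)) ((c z₀).inv₀ hv0)
  have a5 : ContinuousAt (fun y => jTheta (y * z₁ * z₀) q) x :=
    ContinuousAt.comp (f := fun y => y * z₁ * z₀) (continuousAt_jTheta hq0 hq1
      (mul_ne_zero hu0 hz₀) hw) ((c z₁).mul continuousAt_const)
  exact (((continuousAt_const.mul a1).sub (continuousAt_const.mul a2)).mul (a3.mul a4)).sub
    ((continuousAt_const.mul a5).mul continuousAt_const)

theorem appellDefect_eq_zero (hq0 : q ≠ 0) (hq1 : ‖q‖ < 1) {x z₀ z₁ : ℂ} (hx : x ≠ 0)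
    (hz₀ : z₀ ≠ 0) (hz₁ : z₁ ≠ 0) (hv : ∀ k : ℤ, x * z₀ ≠ q ^ k) (hu : ∀ k : ℤ, x * z₁ ≠ q ^ k)
    (hw : ∀ k : ℤ, x * z₁ * z₀ ≠ q ^ k) : appellDefect q z₀ z₁ x = 0 := by
  by_cases h : ∀ k : ℤ, ‖x * z₁‖ ≠ ‖q‖ ^ k
  · exact appellDefect_eq_zero_of_norm_ne hq0 hq1 hx hz₀ hz₁ hv h
  push Not at h
  obtain ⟨m, hm⟩ := h
  have hq : 0 < ‖q‖ := norm_pos_iff.2 hq0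
  -- On an excluded circle, approach `x` radially from outside: for `1 < t < ‖q‖⁻¹` the norm of `t *
  -- x * z₁` lies strictly between consecutive powers of `‖q‖`.
  have hpath : Tendsto (fun t : ℝ => (t : ℂ) * x) (𝓝[>] 1) (𝓝 x) := by
    have : Tendsto (fun t : ℝ => (t : ℂ) * x) (𝓝 1) (𝓝 (((1 : ℝ) : ℂ) * x)) :=
      Continuous.tendsto (by fun_prop) 1
    rw [Complex.ofReal_one, one_mul] at this
    exact this.mono_left nhdsWithin_le_nhds
  have h1 := (continuousAt_appellDefect hq0 hq1 hx hz₀ hz₁ hv hu hw).tendsto.comp hpath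
  refine tendsto_nhds_unique h1 (tendsto_const_nhds.congr' ?_)
  have h2 : Tendsto (fun t : ℝ => (t : ℂ) * x * z₀) (𝓝[>] 1) (𝓝 (x * z₀)) :=
    hpath.mul tendsto_const_nhds
  have h3 : Set.Ioo (1 : ℝ) ‖q‖⁻¹ ∈ 𝓝[>] (1 : ℝ) :=
    Ioo_mem_nhdsGT ((one_lt_inv₀ hq).2 hq1)
  filter_upwards [h2.eventually (eventually_ne_zpow hq0 hq1 (mul_ne_zero hx hz₀) hv), h3]
    with t ht1 ht2
  have ht0 : 0 < t := one_pos.trans ht2.1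
  refine (appellDefect_eq_zero_of_norm_ne hq0 hq1 (mul_ne_zero (by exact_mod_cast ht0.ne') hx)
    hz₀ hz₁ ht1 fun k hk => ?_).symm
  rw [mul_assoc, norm_mul, hm, Complex.norm_real, Real.norm_of_nonneg ht0.le] at hk
  have h4 : t = ‖q‖ ^ (k - m) := by
    rw [zpow_sub₀ hq.ne', ← hk, mul_div_cancel_right₀ _ (zpow_ne_zero _ hq.ne')]
  rcases lt_or_ge (k - m) 0 with h5 | h5
  · have := zpow_le_zpow_right_of_le_one₀ hq hq1.le (show k - m ≤ -1 by omega)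
    rw [← h4, zpow_neg_one] at this
    exact absurd ht2.2 (not_lt.2 this)
  · have := zpow_le_one₀ hq hq1.le h5
    rw [← h4] at this
    exact absurd ht2.1 (not_lt.2 this)

/-! ### Product identities -/

theorem norm_sq_lt_one (hq1 : ‖q‖ < 1) : ‖q ^ 2‖ < 1 := by
  rw [norm_pow]
  exact pow_lt_one₀ (norm_nonneg _) hq1 two_ne_zero

theorem qPochInf_mul_neg (x : ℂ) (hq1 : ‖q‖ < 1) :
    qPochInf x q * qPochInf (-x) q = qPochInf (x ^ 2) (q ^ 2) := by
  refine tendsto_nhds_unique ((tendsto_qPoch x hq1).mul (tendsto_qPoch (-x) hq1))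
    ((tendsto_qPoch (x ^ 2) (norm_sq_lt_one hq1)).congr fun n => ?_)
  simp only [qPoch, ← Finset.prod_mul_distrib]
  exact Finset.prod_congr rfl fun i _ => by ring

theorem qPochInf_sq_mul (x : ℂ) (hq1 : ‖q‖ < 1) :
    qPochInf x (q ^ 2) * qPochInf (q * x) (q ^ 2) = qPochInf x q := by
  have h2 := norm_sq_lt_one hq1
  refine tendsto_nhds_unique ((tendsto_qPoch x h2).mul (tendsto_qPoch (q * x) h2))
    (((tendsto_qPoch x hq1).comp (tendsto_id.const_mul_atTop' two_pos)).congr fun n => ?_)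
  simp only [Function.comp, id]
  induction n with
  | zero => simp
  | succ n ih =>
    rw [show 2 * (n + 1) = 2 * n + 1 + 1 by ring, qPoch_succ, qPoch_succ, ih, qPoch_succ, qPoch_succ]
    ring

/-- Pairing `x` with `-x` and splitting products by the parity of the exponent reduces both sides to
the same infinite products. The factor 2 is `1 - (-1)`, split off from `(-1; q)_∞`. -/
theorem jTheta_product_identity (hq0 : q ≠ 0) (hq1 : ‖q‖ < 1) {a : ℂ} (ha : a ≠ 0) :
    2 * qPochInf q q ^ 2 * (eulerJ 2 q ^ 2 * jTheta (a ^ 4) (q ^ 2)) =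
      jTheta a q * jTheta (-a) q * jTheta (-a ^ 2) q * jTheta (-1) q *
        jTheta (q * a ^ 2) (q ^ 2) := by
  have e1 := qPochInf_mul_neg a hq1
  have e2 := qPochInf_mul_neg (q / a) hq1
  have e3 := qPochInf_sq_mul (a ^ 2) hq1
  have e4 := qPochInf_sq_mul (q / a ^ 2) hq1
  have e5 := qPochInf_mul_neg (a ^ 2) hq1
  have e6 := qPochInf_mul_neg (q / a ^ 2) hq1
  have e7 := qPochInf_mul_neg q hq1
  have e8 := qPochInf_eq_mul (-1) hq1
  rw [div_pow] at e2
  rw [← pow_mul] at e5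
  rw [div_pow, ← pow_mul] at e6
  rw [show q * (q / a ^ 2) = q ^ 2 / a ^ 2 by ring] at e4
  rw [mul_neg_one] at e8
  simp only [jTheta, eulerJ, div_neg, div_one]
  rw [show q ^ 2 / (q * a ^ 2) = q / a ^ 2 by field_simp]
  symm
  calc _ = (qPochInf a q * qPochInf (-a) q) * (qPochInf (q / a) q * qPochInf (-(q / a)) q) *
        (qPochInf (-a ^ 2) q * qPochInf (-(q / a ^ 2)) q) * (qPochInf (-1) q * qPochInf (-q) q) *
        qPochInf q q ^ 4 * (qPochInf (q * a ^ 2) (q ^ 2) * qPochInf (q / a ^ 2) (q ^ 2) *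
          qPochInf (q ^ 2) (q ^ 2)) := by ring
    _ = (qPochInf (a ^ 2) (q ^ 2) * qPochInf (q * a ^ 2) (q ^ 2)) *
        (qPochInf (q / a ^ 2) (q ^ 2) * qPochInf (q ^ 2 / a ^ 2) (q ^ 2)) *
        (qPochInf (-a ^ 2) q * qPochInf (-(q / a ^ 2)) q) * (qPochInf (-1) q * qPochInf (-q) q) *
        qPochInf q q ^ 4 * qPochInf (q ^ 2) (q ^ 2) := by rw [e1, e2]; ring
    _ = (qPochInf (a ^ 2) q * qPochInf (-a ^ 2) q) *
        (qPochInf (q / a ^ 2) q * qPochInf (-(q / a ^ 2)) q) * (2 * qPochInf (-q) q *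
        qPochInf (-q) q) * qPochInf q q ^ 4 * qPochInf (q ^ 2) (q ^ 2) := by
          rw [e3, e4, e8]; ring
    _ = _ := by rw [e5, e6, ← e7]; ring

/-! ### From `z = -a⁻¹` to `z = -1`. -/

theorem neg_one_ne_zpow (hq0 : q ≠ 0) (hq1 : ‖q‖ < 1) (k : ℤ) : (-1 : ℂ) ≠ q ^ k := by
  intro h
  have hq : 0 < ‖q‖ := norm_pos_iff.2 hq0
  have h1 : ‖q‖ ^ k = 1 := by rw [← norm_zpow, ← h]; simp
  rcases (zpow_eq_one_iff_right₀ hq.le hq1.ne).1 h1 with rfl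
  norm_num at h

theorem tsum_appellLerchTerm (hq0 : q ≠ 0) (x z : ℂ) :
    ∑' r : ℤ, appellLerchTerm x q z r = appellSeries q z (x / q * z) := by
  rw [appellSeries]
  refine tsum_congr fun r => ?_
  rw [appellLerchTerm_eq hq0, div_mul_eq_mul_div]

/-- The change of `z` is applied with `x = a ^ 2 / q`, `z₀ = -1`, `z₁ = -a⁻¹`; dividing by `q`
accounts for the exponent `r - 1` in the Appell-Lerch denominators. `jTheta_product_identity` then
rewrites the correction. -/
theorem appellLerch_sub (hq0 : q ≠ 0) (hq1 : ‖q‖ < 1) {a : ℂ} (ha0 : a ≠ 0)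
    (h1 : ∀ k : ℤ, a ≠ q ^ k) (h2 : ∀ k : ℤ, -a ≠ q ^ k) (h3 : ∀ k : ℤ, -a ^ 2 ≠ q ^ k)
    (h4 : ∀ k : ℤ, a ^ 4 ≠ (q ^ 2) ^ k) :
    jTheta (-a) q / eulerJ 1 q * appellLerch (a ^ 2) q (-a⁻¹) =
      jTheta (-a) q / eulerJ 1 q * appellLerch (a ^ 2) q (-1)
          + 1 / 2 * (jTheta a q ^ 3 * jTheta (q * a ^ 2) (q ^ 2)
              / (eulerJ 2 q ^ 2 * jTheta (a ^ 4) (q ^ 2))) := by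
  have hx : a ^ 2 / q ≠ 0 := div_ne_zero (pow_ne_zero 2 ha0) hq0
  have hz₁ : -a⁻¹ ≠ 0 := neg_ne_zero.2 (inv_ne_zero ha0)
  have u0 : a ^ 2 / q * -a⁻¹ = -a / q := by field_simp
  have v0 : a ^ 2 / q * -1 = -a ^ 2 / q := by ring
  have hd := appellDefect_eq_zero hq0 hq1 hx (neg_ne_zero.2 one_ne_zero) hz₁
    (by rw [v0]; exact div_ne_zpow hq0 h3) (by rw [u0]; exact div_ne_zpow hq0 h2)
    (by rw [u0, mul_neg_one, neg_div, neg_neg]; exact div_ne_zpow hq0 h1)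
  have hE := qPochInf_self_ne_zero hq1
  have j1 := jTheta_ne_zero hq1 (neg_ne_zero.2 ha0) h2
  have j2 := jTheta_ne_zero hq1 (neg_ne_zero.2 (pow_ne_zero 2 ha0)) h3
  have j3 := jTheta_ne_zero hq1 (neg_ne_zero.2 one_ne_zero) (neg_one_ne_zpow hq0 hq1)
  have j4 := jTheta_ne_zero (norm_sq_lt_one hq1) (pow_ne_zero 4 ha0) h4
  have j5 : eulerJ 2 q ≠ 0 := qPochInf_self_ne_zero (norm_sq_lt_one hq1)
  have e1 : jTheta (-a⁻¹) q = a⁻¹ * jTheta (-a) q := by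
    have := jTheta_inv hq0 hq1 (neg_ne_zero.2 ha0)
    rw [inv_neg] at this
    rw [this]; ring
  have e2 (w : ℂ) (hw : w ≠ 0) : jTheta (w / q) q = -(w / q) * jTheta w q := by
    have := jTheta_mul_self hq0 hq1 (div_ne_zero hw hq0)
    rw [mul_div_cancel₀ _ hq0] at this
    rw [this]
    field_simp
  have e3 : jTheta (-a ^ 2 / q)⁻¹ q = jTheta (-a ^ 2) q := by rw [inv_div, jTheta_div hq0]
  have e4 : jTheta (-a⁻¹ / -1) q = -a⁻¹ * jTheta a q := by
    rw [neg_div_neg_eq, div_one, jTheta_inv hq0 hq1 ha0]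
  rw [appellDefect, ← tsum_appellLerchTerm hq0, ← tsum_appellLerchTerm hq0, v0, u0, e3, e4,
    mul_neg_one, neg_div, neg_neg, e2 a ha0, ← neg_div, e2 (-a) (neg_ne_zero.2 ha0), e1] at hd
  have hp := jTheta_product_identity hq0 hq1 ha0
  rw [appellLerch, appellLerch, e1, eulerJ_one]
  generalize ∑' r : ℤ, appellLerchTerm (a ^ 2) q (-a⁻¹) r = A at hd ⊢
  generalize ∑' r : ℤ, appellLerchTerm (a ^ 2) q (-1) r = B at hd ⊢
  generalize jTheta (-a) q = P at *
  generalize jTheta (-a ^ 2) q = R at *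
  generalize jTheta (-1) q = S at *
  generalize jTheta (a ^ 4) (q ^ 2) = T at *
  generalize jTheta (q * a ^ 2) (q ^ 2) = U at *
  generalize eulerJ 2 q = V at *
  generalize qPochInf q q = E at *
  generalize jTheta a q = G at *
  have key : a * A * S - P * B = E ^ 3 * G ^ 2 / (P * R) := by
    rw [eq_div_iff (mul_ne_zero j1 j2)]
    field_simp at hd
    linear_combination hd
  have key2 : G ^ 3 * U / (V ^ 2 * T) = 2 * E ^ 2 * G ^ 2 / (P * R * S) := by
    rw [div_eq_div_iff (by positivity) (by positivity)]
    linear_combination (-1) * G ^ 2 * hp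
  rw [key2]
  have key3 : P / E * (1 / (a⁻¹ * P) * A) - P / E * (1 / S * B) =
      (a * A * S - P * B) / (E * S) := by
    field_simp
  rw [← sub_eq_iff_eq_add', key3, key]
  field_simp

end QSeries

/-- In each part the hypothesis on `a` says exactly that no denominator of the identity vanishes. -/
theorem mainTheorem4 (q a : ℂ) (hq0 : q ≠ 0) (hq1 : ‖q‖ < 1) (ha : a ≠ 0) :
    Summable (dualTerm a q) ∧
    ((∀ k : ℤ, -a ≠ q ^ k) →
      Summable (mockGTerm (-a) q) ∧
      Summable (appellLerchTerm (a ^ 2) q (-a⁻¹)) ∧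
      jTheta (-a⁻¹) q ≠ 0 ∧
      (1 + 1 / a) * ∑' n : ℕ, dualTerm a q n =
        -1 + a * mockG (-a) q
          + jTheta (-a) q / eulerJ 1 q * appellLerch (a ^ 2) q (-a⁻¹)) ∧
    ((∀ k : ℤ, a ^ 4 ≠ q ^ (2 * k)) →
      Summable (mockGTerm (-a) q) ∧
      Summable (appellLerchTerm (a ^ 2) q (-1)) ∧
      jTheta (-1) q ≠ 0 ∧
      jTheta (a ^ 4) (q ^ 2) ≠ 0 ∧
      (1 + 1 / a) * ∑' n : ℕ, dualTerm a q n =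
        -1 + a * mockG (-a) q
          + jTheta (-a) q / eulerJ 1 q * appellLerch (a ^ 2) q (-1)
          + 1 / 2 * (jTheta a q ^ 3 * jTheta (q * a ^ 2) (q ^ 2)
              / (eulerJ 2 q ^ 2 * jTheta (a ^ 4) (q ^ 2)))) := by
  have ha2 := pow_ne_zero 2 ha
  refine ⟨summable_dualTerm a hq1, fun h => ⟨(hasSum_mockGTerm hq0 hq1 (neg_ne_zero.2 ha) h).summable,
    summable_appellLerchTerm hq0 hq1 ha2 (neg_ne_zero.2 (inv_ne_zero ha)) fun k => ?_,
    jTheta_ne_zero hq1 (neg_ne_zero.2 (inv_ne_zero ha)) ?_, dual_eq_appellLerch hq0 hq1 ha h⟩,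
    fun h => ?_⟩
  · rw [show a ^ 2 * -a⁻¹ = -a by field_simp]
    exact h k
  · rw [← inv_neg]
    exact inv_ne_zpow h
  · have h4 (k : ℤ) : a ^ 4 ≠ (q ^ 2) ^ k := by
      have := h k
      rwa [zpow_mul] at this
    -- If `a`, `-a` or `-a ^ 2` were a power of `q`, its fourth, fourth or second power would put `a
    -- ^ 4` among the even powers of `q`.
    have h1 (k : ℤ) : a ≠ q ^ k := fun e => h (2 * k) (by
      rw [e, ← zpow_natCast, ← zpow_mul]; congr 1; push_cast; ring)
    have h2 (k : ℤ) : -a ≠ q ^ k := fun e => h (2 * k) (by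
      rw [← Even.neg_pow (by decide : Even 4), e, ← zpow_natCast, ← zpow_mul]
      congr 1; push_cast; ring)
    have h3 (k : ℤ) : -a ^ 2 ≠ q ^ k := fun e => h k (by
      rw [show a ^ 4 = (-a ^ 2) ^ 2 by ring, e, ← zpow_natCast, ← zpow_mul]
      congr 1; push_cast; ring)
    refine ⟨(hasSum_mockGTerm hq0 hq1 (neg_ne_zero.2 ha) h2).summable,
      summable_appellLerchTerm hq0 hq1 ha2 (neg_ne_zero.2 one_ne_zero) fun k => ?_,
      jTheta_ne_zero hq1 (neg_ne_zero.2 one_ne_zero) (neg_one_ne_zpow hq0 hq1),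
      jTheta_ne_zero (norm_sq_lt_one hq1) (pow_ne_zero 4 ha) h4, ?_⟩
    · rw [mul_neg_one]
      exact h3 k
    · rw [dual_eq_appellLerch hq0 hq1 ha h2, appellLerch_sub hq0 hq1 ha h1 h2 h3 h4, add_assoc]
      ring
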